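/- Let $G\le SO(n)$ be a compact subgroup acting on $\mathbb R^n$, let $V=\mathbb C^k$ and $W=\mathbb C^l$ carry representations of $G$, and fix $g\in G$ acting on $V$ and $W$ by the matrices $g^V,g^W$; put $\gamma=\operatorname{diag}(g^V,g^W)$. Let $(\mathbb R^n)^g$ be the fixed subspace of $g$, $n_g=\dim(\mathbb R^n)^g$, and let $\det(g-1)$ be the determinant of $g-1$ on the orthogonal complement of $(\mathbb R^n)^g$. Let $x_1,\dots,x_{n_g}$ be coordinates with respect to an orthonormal basis of $(\mathbb R^n)^g$ (extended to $\mathbb R^n$ as linear functionals vanishing on the orthogonal complement), with corresponding derivatives $\partial_{x_j}$ and dual coordinates $\xi_j$. For $f\in\mathcal S(T^*\mathbb R^n\times\mathbb R;\operatorname{End}(V\oplus W))$ put $\hat f(x,y,h)=\int_{\mathbb R^n}f(x,\xi,h)e^{-i\langle y,\xi\rangle}\,d\xi$; for $\hbar>0$ let $\rho_\hbar(\hat f)$ be the operator $$(\rho_\hbar(\hat f)\phi)(x)=\frac1{(2\pi)^n}\int_{\mathbb R^n}\hat f(x,y,\hbar)\,\phi(x+\hbar y)\,dy ,$$ and let $\rho_0(\hat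 f)(x,\xi)=f(x,\xi,0)$. Let $(\hat g\phi)(x)=\gamma\,\phi(g^{-1}x)$, $\delta_{2j-1}(S)=[\partial_{x_j},S]$, $\delta_{2j}(S)=[x_j,S]$ for $1\le j\le n_g$, and $$\omega_g(T_0,\dots,T_{2n_g})=\frac{(-1)^{n_g}}{n_g!}\sum_{\sigma\in S_{2n_g}}\operatorname{sgn}(\sigma)\operatorname{Tr}\bigl(\hat g\,T_0\,\delta_{\sigma(1)}(T_1)\cdots\delta_{\sigma(2n_g)}(T_{2n_g})\bigr),$$ with $\operatorname{Tr}$ the trace on $L^2(\mathbb R^n;V\oplus W)$. For $F_0,\dots,F_{2n_g}\in\mathcal S(T^*\mathbb R^n;\operatorname{End}(V\oplus W))$ let $$\epsilon_g(F_0,\dots,F_{2n_g})=\frac1{(2\pi i)^{n_g}\,n_g!\,\det(g-1)}\int_{T^*(\mathbb R^n)^g}\operatorname{tr}\bigl[\gamma\,F_0\,dF_1\cdots dF_{2n_g}\bigr],$$ where $T^*(\mathbb R^n)^g=(\mathbb R^n)^g\times(\mathbb R^n)^g$ is oriented by $dx_1\wedge d\xi_1\wedge\cdots\wedge dx_{n_g}\wedge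 d\xi_{n_g}$. **Lemma 3.9.** If $n_g>0$ and $f_0,\dots,f_{2n_g}\in\mathcal S(T^*\mathbb R^n\times\mathbb R;\operatorname{End}(V\oplus W))$, then the operators $\hat g\,\rho_\hbar(\hat f_0)\,\delta_{\sigma(1)}(\rho_\hbar(\hat f_1))\cdots\delta_{\sigma(2n_g)}(\rho_\hbar(\hat f_{2n_g}))$ are trace class for all $\hbar>0$ and $\sigma\in S_{2n_g}$, the integral defining $\epsilon_g(\rho_0(\hat f_0),\dots,\rho_0(\hat f_{2n_g}))$ converges absolutely, and $$\lim_{\hbar\to0^+}\omega_g\bigl(\rho_\hbar(\hat f_0),\dots,\rho_\hbar(\hat f_{2n_g})\bigr)=\epsilon_g\bigl(\rho_0(\hat f_0),\dots,\rho_0(\hat f_{2n_g})\bigr).$$ -/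

import Mathlib

open MeasureTheory Filter Topology
open scoped SchwartzMap LineDeriv

namespace EquivariantIndex

/-- Euclidean space `ℝⁿ`. The cotangent space `T*ℝⁿ` is `Rn n × Rn n`, with points `(x, ξ)`. -/
abbrev Rn (n : ℕ) := EuclideanSpace ℝ (Fin n)

/-! ### Auxiliary facts: the operators `ρ_ħ(f̂)` preserve the Schwartz space -/

theorem schwartz_section_bound {n : ℕ} {F : Type*} [NormedAddCommGroup F] [NormedSpace ℝ F]
    (H : 𝓢(Rn n × Rn n, F)) (k : ℕ) :
    ∃ C : ℝ, ∀ x ξ, ‖x‖ ^ k * ‖H (x, ξ)‖ ≤ C * (1 + ‖ξ‖) ^ (-((n : ℝ) + 1)) := by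
  refine ⟨2 ^ (k + (n + 1)) * (Finset.Iic (k + (n + 1), 0)).sup
    (fun m => SchwartzMap.seminorm ℝ m.1 m.2) H, fun x ξ => ?_⟩
  have h := SchwartzMap.one_add_le_sup_seminorm_apply (𝕜 := ℝ) (m := (k + (n + 1), 0))
    (le_refl (k + (n + 1))) (le_refl 0) H (x, ξ)
  rw [norm_iteratedFDeriv_zero] at h
  have e : (1 + ‖ξ‖) ^ (-((n : ℝ) + 1)) = ((1 + ‖ξ‖) ^ (n + 1))⁻¹ := by
    rw [Real.rpow_neg (by positivity)]
    congr 1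
    exact_mod_cast Real.rpow_natCast (1 + ‖ξ‖) (n + 1)
  rw [e, ← div_eq_mul_inv, le_div_iff₀ (by positivity)]
  refine le_trans ?_ h
  have h1 : ‖x‖ ≤ 1 + ‖(x, ξ)‖ := (norm_fst_le (x, ξ)).trans (by linarith)
  have h2 : 1 + ‖ξ‖ ≤ 1 + ‖(x, ξ)‖ := by linarith [norm_snd_le (x, ξ)]
  rw [pow_add (1 + ‖(x, ξ)‖)]
  calc ‖x‖ ^ k * ‖H (x, ξ)‖ * (1 + ‖ξ‖) ^ (n + 1)
      = ‖x‖ ^ k * (1 + ‖ξ‖) ^ (n + 1) * ‖H (x, ξ)‖ := by ring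
    _ ≤ _ := by gcongr

theorem schwartz_section_integrable {n : ℕ} {F : Type*} [NormedAddCommGroup F] [NormedSpace ℝ F]
    (H : 𝓢(Rn n × Rn n, F))
    (x : Rn n) : Integrable fun ξ => H (x, ξ) := by
  obtain ⟨C, hC⟩ := schwartz_section_bound H 0
  have hb : Integrable fun ξ : Rn n =>
      C * (1 + ‖ξ‖) ^ (-((n : ℝ) + 1)) :=
    (integrable_one_add_norm (by simp)).const_mul C
  refine hb.mono' (by have := H.continuous; fun_prop) (ae_of_all _ fun ξ => ?_)
  simpa using hC x ξ

theorem schwartz_partial_integral_aux {n : ℕ} (m : ℕ) : ∀ {F : Type*} [NormedAddCommGroup F]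
    [NormedSpace ℝ F] (H : 𝓢(Rn n × Rn n, F)),
    ContDiff ℝ m (fun x => ∫ ξ, H (x, ξ)) ∧
    ∀ k : ℕ, ∃ C : ℝ, ∀ x, ‖x‖ ^ k * ‖iteratedFDeriv ℝ m (fun x => ∫ ξ, H (x, ξ)) x‖ ≤ C := by
  induction m with
  | zero =>
    intro F _ _ H
    constructor
    · obtain ⟨C, hC⟩ := schwartz_section_bound H 0
      have hH := H.continuous
      rw [CharP.cast_eq_zero, contDiff_zero]
      refine continuous_of_dominated (bound := fun ξ => C * (1 + ‖ξ‖) ^ (-((n : ℝ) + 1)))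
        (fun x => by fun_prop) (fun x => ae_of_all _ fun ξ => by simpa using hC x ξ)
        ((integrable_one_add_norm (by simp)).const_mul C) (ae_of_all _ fun ξ => by fun_prop)
    · intro k
      obtain ⟨C, hC⟩ := schwartz_section_bound H k
      refine ⟨∫ ξ : Rn n, C * (1 + ‖ξ‖) ^ (-((n : ℝ) + 1)), fun x => ?_⟩
      rw [norm_iteratedFDeriv_zero, ← norm_norm x, ← norm_pow, ← norm_smul, ← integral_smul]
      refine norm_integral_le_of_norm_le ((integrable_one_add_norm (by simp)).const_mul C)
        (ae_of_all _ fun ξ => ?_)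
      rw [norm_smul, norm_pow, norm_norm]
      exact hC x ξ
  | succ m ih =>
    intro F _ _ H
    let H' : 𝓢(Rn n × Rn n,
        Rn n →L[ℝ] F) :=
      SchwartzMap.postcompCLM ((ContinuousLinearMap.compL ℝ _ _ F).flip
        (ContinuousLinearMap.inl ℝ (Rn n) (Rn n)))
        (SchwartzMap.fderivCLM ℝ _ F H)
    have hd : ∀ x, HasFDerivAt (fun x => ∫ ξ, H (x, ξ)) (∫ ξ, H' (x, ξ)) x := by
      intro x
      obtain ⟨C, hC⟩ := schwartz_section_bound H' 0
      have hH := H.continuous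
      have hH' := H'.continuous
      refine hasFDerivAt_integral_of_dominated_of_fderiv_le (F := fun x ξ => H (x, ξ))
        (F' := fun x ξ => H' (x, ξ)) (bound := fun ξ => C * (1 + ‖ξ‖) ^ (-((n : ℝ) + 1)))
        univ_mem (Eventually.of_forall fun x => by fun_prop)
        (schwartz_section_integrable H x) (by fun_prop)
        (ae_of_all _ fun ξ x _ => by simpa using hC x ξ)
        ((integrable_one_add_norm (by simp)).const_mul C) (ae_of_all _ fun ξ x _ => ?_)
      have h1 : HasFDerivAt H (fderiv ℝ H (x, ξ)) (x, ξ) := H.hasFDerivAt (x, ξ)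
      exact HasFDerivAt.comp (𝕜 := ℝ) (f := fun x => (x, ξ)) x h1 (hasFDerivAt_prodMk_left x ξ)
    have hfd : fderiv ℝ (fun x => ∫ ξ, H (x, ξ)) = fun x => ∫ ξ, H' (x, ξ) :=
      funext fun x => (hd x).fderiv
    obtain ⟨i1, i2⟩ := ih H'
    constructor
    · rw [Nat.cast_succ, contDiff_succ_iff_fderiv]
      refine ⟨fun x => (hd x).differentiableAt, by simp, ?_⟩
      rw [hfd]
      exact i1
    · intro k
      obtain ⟨C, hC⟩ := i2 k
      refine ⟨C, fun x => ?_⟩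
      rw [← norm_iteratedFDeriv_fderiv, hfd]
      exact hC x

/-- Integrating out the second variable of a Schwartz function gives a Schwartz function. -/
noncomputable def schwartzPartialIntegral {n : ℕ} {F : Type*} [NormedAddCommGroup F]
    [NormedSpace ℝ F] (H : 𝓢(Rn n × Rn n, F)) :
    𝓢(Rn n, F) where
  toFun x := ∫ ξ, H (x, ξ)
  smooth' := contDiff_infty.2 fun m => (schwartz_partial_integral_aux m H).1
  decay' k m := (schwartz_partial_integral_aux m H).2 k

theorem temperate_cexp (c : ℝ) :
    Function.HasTemperateGrowth fun t : ℝ => Complex.exp (Complex.I * (c * t : ℝ)) := by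
  have hk : ∀ k : ℕ, iteratedDeriv k (fun t : ℝ => Complex.exp (Complex.I * (c * t : ℝ))) =
      fun t : ℝ => (Complex.I * c) ^ k * Complex.exp (Complex.I * (c * t : ℝ)) := by
    intro k
    induction k with
    | zero => simp
    | succ k ih =>
      rw [iteratedDeriv_succ, ih]
      funext t
      have h1 : HasDerivAt (fun t : ℝ => Complex.I * ((c * t : ℝ) : ℂ)) (Complex.I * c) t := by
        have := (((hasDerivAt_id t).const_mul c).ofReal_comp).const_mul Complex.I
        simpa using this
      rw [(h1.cexp.const_mul _).deriv]
      ring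
  refine ⟨?_, fun k => ⟨0, |c| ^ k, fun t => ?_⟩⟩
  · have : ContDiff ℝ (⊤ : ℕ∞) (fun t : ℝ => ((c * t : ℝ) : ℂ)) :=
      Complex.ofRealCLM.contDiff.comp (contDiff_const.mul contDiff_id)
    fun_prop
  · rw [norm_iteratedFDeriv_eq_norm_iteratedDeriv, hk]
    simp [Complex.norm_exp]

/-- The restriction `(x, ξ) ↦ f (x, ξ, ħ)` of a Schwartz function on `T*ℝⁿ × ℝ`. -/
noncomputable def schwartzSlice {n : ℕ} {F : Type*} [NormedAddCommGroup F] [NormedSpace ℂ F] (ħ : ℝ)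
    (f : 𝓢(Rn n × Rn n × ℝ, F)) :
    𝓢(Rn n × Rn n, F) :=
  SchwartzMap.compCLM ℂ (g := fun p => (p.1, p.2, ħ))
    (by
      have := (ContinuousLinearMap.hasTemperateGrowth
        ((ContinuousLinearMap.fst ℝ (Rn n) (Rn n)).prod
          ((ContinuousLinearMap.snd ℝ (Rn n) (Rn n)).prod
            (0 : _ →L[ℝ] ℝ)))).add (Function.HasTemperateGrowth.const
              ((0 : Rn n), (0 : Rn n), ħ))
      convert! this using 1
      funext p
      simp)
    (by
      refine ⟨1, 1, fun p => ?_⟩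
      have a : ‖p.1‖ ≤ ‖(p.1, p.2, ħ)‖ := norm_fst_le (p.1, p.2, ħ)
      have b : ‖p.2‖ ≤ ‖(p.1, p.2, ħ)‖ :=
        (norm_fst_le (p.2, ħ)).trans (norm_snd_le (p.1, p.2, ħ))
      rw [Prod.norm_def p]
      have := max_le a b
      linarith) f

theorem schwartzSlice_apply {n : ℕ} {F : Type*} [NormedAddCommGroup F] [NormedSpace ℂ F] (ħ : ℝ)
    (f : 𝓢(Rn n × Rn n × ℝ, F))
    (x ξ : Rn n) : schwartzSlice ħ f (x, ξ) = f (x, ξ, ħ) := rfl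

theorem exists_rho_kernel {n : ℕ} {F : Type*} [NormedAddCommGroup F] [NormedSpace ℂ F] (ħ : ℝ)
    (f : 𝓢(Rn n × Rn n × ℝ, F →L[ℂ] F))
    (φ : 𝓢(Rn n, F)) :
    ∃ H : 𝓢(Rn n × Rn n, F),
      ∀ x ξ, H (x, ξ) = Complex.exp (Complex.I * (ħ⁻¹ * inner ℝ x ξ : ℝ)) •
        f (x, ξ, ħ) (FourierTransform.fourier φ ((2 * Real.pi * ħ)⁻¹ • ξ)) := by
  have h3 : Function.HasTemperateGrowth
      (fun p : Rn n × Rn n =>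
        FourierTransform.fourier φ ((2 * Real.pi * ħ)⁻¹ • p.2)) :=
    (FourierTransform.fourier φ).hasTemperateGrowth.comp
      (f := fun p : Rn n × Rn n =>
        (2 * Real.pi * ħ)⁻¹ • p.2)
      (ContinuousLinearMap.hasTemperateGrowth
        ((2 * Real.pi * ħ)⁻¹ • ContinuousLinearMap.snd ℝ (Rn n)
          (Rn n)))
  have h4 : Function.HasTemperateGrowth
      (fun p : Rn n × Rn n =>
        Complex.exp (Complex.I * (ħ⁻¹ * inner ℝ p.1 p.2 : ℝ))) :=
    (temperate_cexp ħ⁻¹).comp (f := fun p : Rn n × Rn n =>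
        inner ℝ p.1 p.2)
      ((innerSL ℝ).bilinear_hasTemperateGrowth
        (ContinuousLinearMap.hasTemperateGrowth (ContinuousLinearMap.fst ℝ
          (Rn n) (Rn n)))
        (ContinuousLinearMap.hasTemperateGrowth (ContinuousLinearMap.snd ℝ
          (Rn n) (Rn n))))
  refine ⟨SchwartzMap.smulLeftCLM F (fun p => Complex.exp (Complex.I * (ħ⁻¹ * inner ℝ p.1 p.2 : ℝ)))
    (SchwartzMap.bilinLeftCLM (ContinuousLinearMap.id ℂ (F →L[ℂ] F)) h3
      (schwartzSlice ħ f)), fun x ξ => ?_⟩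
  rw [SchwartzMap.smulLeftCLM_apply_apply h4]
  rfl

theorem inner_integral_eq {n : ℕ} {F : Type*} [NormedAddCommGroup F] [NormedSpace ℂ F]
    {ħ : ℝ} (hħ : 0 < ħ) (φ : 𝓢(Rn n, F)) (x ξ : Rn n) :
    ∫ y, Complex.exp (-(Complex.I * (inner ℝ y ξ : ℝ))) • φ (x + ħ • y) =
      (ħ ^ n)⁻¹ • Complex.exp (Complex.I * (ħ⁻¹ * inner ℝ x ξ : ℝ)) •
        FourierTransform.fourier φ ((2 * Real.pi * ħ)⁻¹ • ξ) := by
  set ψ : Rn n → F := fun z =>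
    Complex.exp (-(Complex.I * (ħ⁻¹ * inner ℝ (z - x) ξ : ℝ))) • φ z with hψ
  have e1 : ∀ y, Complex.exp (-(Complex.I * (inner ℝ y ξ : ℝ))) • φ (x + ħ • y) =
      ψ (x + ħ • y) := by
    intro y
    simp only [hψ, add_sub_cancel_left, inner_smul_left]
    congr 4
    simp [hħ.ne']
  simp_rw [e1]
  rw [Measure.integral_comp_smul_of_nonneg volume (fun z => ψ (x + z)) ħ (hR := hħ.le),
    integral_add_left_eq_self (μ := volume) ψ x, finrank_euclideanSpace_fin, SchwartzMap.fourier_coe,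
    Real.fourier_eq']
  congr 1
  rw [← integral_smul]
  apply integral_congr_ae
  filter_upwards with z
  simp only [hψ, smul_smul, ← Complex.exp_add]
  congr 2
  simp only [inner_sub_left, inner_smul_right]
  push_cast
  have : (ħ : ℂ) ≠ 0 := by exact_mod_cast hħ.ne'
  have hp : (Real.pi : ℂ) ≠ 0 := by exact_mod_cast Real.pi_ne_zero
  field_simp
  ring

/-- The Fourier transform of `f` in the second variable,
`f̂(x, y, h) = ∫ f(x, ξ, h) e^{-i⟨y, ξ⟩} dξ`. -/
noncomputable def partialFourier {n : ℕ} {F : Type*} [NormedAddCommGroup F] [NormedSpace ℂ F]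
    (f : 𝓢(Rn n × Rn n × ℝ, F))
    (x y : Rn n) (h : ℝ) : F :=
  ∫ ξ, Complex.exp (-(Complex.I * (inner ℝ y ξ : ℝ))) • f (x, ξ, h)

theorem rho_formula_eq {n : ℕ} {F : Type*} [NormedAddCommGroup F] [NormedSpace ℂ F]
    [CompleteSpace F] {ħ : ℝ} (hħ : 0 < ħ)
    (f : 𝓢(Rn n × Rn n × ℝ, F →L[ℂ] F))
    (φ : 𝓢(Rn n, F)) (x : Rn n) :
    ∫ y, (∫ ξ, Complex.exp (-(Complex.I * (inner ℝ y ξ : ℝ))) • f (x, ξ, ħ)) (φ (x + ħ • y)) =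
      (ħ ^ n)⁻¹ • ∫ ξ, Complex.exp (Complex.I * (ħ⁻¹ * inner ℝ x ξ : ℝ)) •
        f (x, ξ, ħ) (FourierTransform.fourier φ ((2 * Real.pi * ħ)⁻¹ • ξ)) := by
  have hfi : Integrable fun ξ => f (x, ξ, ħ) := schwartz_section_integrable (schwartzSlice ħ f) x
  have hφi : Integrable fun y => φ (x + ħ • y) := by
    have h0 : Integrable φ volume := φ.integrable
    have h1 : Integrable (fun z => φ (x + z)) := h0.comp_add_left x
    exact h1.comp_smul hħ.ne'
  have hfc := f.continuous
  have hφc := φ.continuous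
  have hexp : ∀ t : ℝ, ‖Complex.exp (-(Complex.I * (t : ℂ)))‖ = 1 := fun t => by
    simp [Complex.norm_exp]
  have e1 : ∀ y, (∫ ξ, Complex.exp (-(Complex.I * (inner ℝ y ξ : ℝ))) • f (x, ξ, ħ))
      (φ (x + ħ • y)) =
      ∫ ξ, f (x, ξ, ħ) (Complex.exp (-(Complex.I * (inner ℝ y ξ : ℝ))) • φ (x + ħ • y)) := by
    intro y
    rw [ContinuousLinearMap.integral_apply]
    · simp
    · refine hfi.norm.mono' (by fun_prop) (ae_of_all _ fun ξ => ?_)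
      rw [norm_smul, hexp, one_mul]
  simp_rw [e1]
  rw [integral_integral_swap]
  · rw [← integral_smul]
    refine integral_congr_ae (ae_of_all _ fun ξ => ?_)
    simp only
    rw [ContinuousLinearMap.integral_comp_comm, inner_integral_eq hħ]
    · simp
    · refine hφi.norm.mono' (by fun_prop) (ae_of_all _ fun y => ?_)
      rw [norm_smul, hexp, one_mul]
  · refine (hφi.norm.mul_prod hfi.norm).mono' ?_ (ae_of_all _ fun p => ?_)
    · refine Continuous.aestronglyMeasurable ?_
      simp only [Function.uncurry_def]
      fun_prop
    · simp only [Function.uncurry_def]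
      refine (ContinuousLinearMap.le_opNorm _ _).trans ?_
      rw [norm_smul, hexp, one_mul, mul_comm]

theorem exists_rho {n : ℕ} {F : Type*} [NormedAddCommGroup F] [NormedSpace ℂ F] [CompleteSpace F]
    {ħ : ℝ} (hħ : 0 < ħ)
    (f : 𝓢(Rn n × Rn n × ℝ, F →L[ℂ] F)) :
    ∃ T : 𝓢(Rn n, F) →ₗ[ℂ] 𝓢(Rn n, F), ∀ φ x,
      T φ x = ((2 * Real.pi) ^ n)⁻¹ • ∫ y, partialFourier f x y ħ (φ (x + ħ • y)) := by
  choose H hH using exists_rho_kernel (n := n) (F := F) ħ f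
  have hadd : ∀ φ ψ x ξ, H (φ + ψ) (x, ξ) = H φ (x, ξ) + H ψ (x, ξ) := by
    intro φ ψ x ξ
    simp [hH, FourierTransform.fourier_add]
  have hsmul : ∀ (c : ℂ) φ x ξ, H (c • φ) (x, ξ) = c • H φ (x, ξ) := by
    intro c φ x ξ
    simp only [hH, FourierTransform.fourier_smul, smul_apply, map_smul]
    rw [smul_comm]
  refine ⟨{ toFun := fun φ => (((2 * Real.pi) ^ n)⁻¹ * (ħ ^ n)⁻¹) • schwartzPartialIntegral (H φ)
            map_add' := ?_
            map_smul' := ?_ }, ?_⟩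
  · intro φ ψ
    rw [← smul_add]
    congr 1
    ext x
    change ∫ ξ, H (φ + ψ) (x, ξ) = (∫ ξ, H φ (x, ξ)) + ∫ ξ, H ψ (x, ξ)
    simp_rw [hadd]
    exact integral_add (schwartz_section_integrable (H φ) x) (schwartz_section_integrable (H ψ) x)
  · intro c φ
    rw [RingHom.id_apply, smul_comm c]
    congr 1
    ext x
    change ∫ ξ, H (c • φ) (x, ξ) = c • ∫ ξ, H φ (x, ξ)
    simp_rw [hsmul]
    exact integral_smul c _
  · intro φ x
    have h := rho_formula_eq hħ f φ x
    simp_rw [← hH] at h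
    rw [show (∫ y, partialFourier f x y ħ (φ (x + ħ • y))) = _ from h, smul_smul]
    rfl

/-- For `ħ > 0`, the operator
`(ρ_ħ(f̂) φ)(x) = (2π)⁻ⁿ ∫ f̂(x, y, ħ) φ(x + ħ y) dy` on `𝓢(ℝⁿ; F)`; it is used for `ħ > 0` only
(for `ħ ≤ 0` the value is set to `0`). At `ħ = 0` the section is `ρ_0(f̂) = schwartzSlice 0 f`. -/
noncomputable def rho {n : ℕ} {F : Type*} [NormedAddCommGroup F] [NormedSpace ℂ F]
    [CompleteSpace F] (ħ : ℝ)
    (f : 𝓢(Rn n × Rn n × ℝ, F →L[ℂ] F)) :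
    Module.End ℂ 𝓢(Rn n, F) :=
  if hħ : 0 < ħ then
    { toFun := fun φ =>
        { toFun := fun x => ((2 * Real.pi) ^ n)⁻¹ • ∫ y, partialFourier f x y ħ (φ (x + ħ • y))
          smooth' := by
            obtain ⟨T, hT⟩ := exists_rho hħ f
            simpa only [← hT] using! (T φ).smooth'
          decay' := by
            obtain ⟨T, hT⟩ := exists_rho hħ f
            simpa only [← hT] using! (T φ).decay' }
      map_add' := fun φ ψ => by
        obtain ⟨T, hT⟩ := exists_rho hħ f
        ext x
        exact ((hT (φ + ψ) x).symm.trans (by rw [map_add]; rfl)).trans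
          (congrArg₂ (· + ·) (hT φ x) (hT ψ x))
      map_smul' := fun c φ => by
        obtain ⟨T, hT⟩ := exists_rho hħ f
        ext x
        exact ((hT (c • φ) x).symm.trans (by rw [map_smul]; rfl)).trans
          (congrArg (c • ·) (hT φ x)) }
  else 0

theorem rho_apply {n : ℕ} {F : Type*} [NormedAddCommGroup F] [NormedSpace ℂ F]
    [CompleteSpace F] {ħ : ℝ} (hħ : 0 < ħ) (f : 𝓢(Rn n × Rn n × ℝ, F →L[ℂ] F))
    (φ : 𝓢(Rn n, F)) (x : Rn n) :
    rho ħ f φ x = ((2 * Real.pi) ^ n)⁻¹ • ∫ y, partialFourier f x y ħ (φ (x + ħ • y)) := by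
  rw [rho, dif_pos hħ]
  rfl

/-! ### Trace-class operators and the trace on `L²` -/

/-- Trace-class (nuclear) operators on a Hilbert space: `T = ∑ᵢ ⟨uᵢ, ·⟩ vᵢ` with
`∑ᵢ ‖uᵢ‖ ‖vᵢ‖ < ∞`. -/
def IsTraceClass {H : Type*} [NormedAddCommGroup H] [InnerProductSpace ℂ H]
    (T : H →L[ℂ] H) : Prop :=
  ∃ u v : ℕ → H, Summable (fun i => ‖u i‖ * ‖v i‖) ∧
    ∀ φ, HasSum (fun i => inner ℂ (u i) φ • v i) (T φ)

/-- The canonical trace `Tr T = ∑ᵢ ⟨eᵢ, T eᵢ⟩` over an orthonormal (Hilbert) basis. -/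
noncomputable def hilbertTrace {H : Type*} [NormedAddCommGroup H] [InnerProductSpace ℂ H]
    [CompleteSpace H] (T : H →L[ℂ] H) : ℂ :=
  ∑' i, inner ℂ ((exists_hilbertBasis ℂ H).choose_spec.choose i)
    (T ((exists_hilbertBasis ℂ H).choose_spec.choose i))

section L2

variable {n : ℕ} {F : Type*} [NormedAddCommGroup F] [InnerProductSpace ℂ F] [CompleteSpace F]

/-- An operator on `𝓢(ℝⁿ; F)` is bounded for the `L²` norm. -/
def IsL2Bounded (A : Module.End ℂ 𝓢(Rn n, F)) : Prop :=
  ∃ C : ℝ, ∀ φ, ‖(A φ).toLp 2 volume‖ ≤ C * ‖φ.toLp 2 volume‖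

/-- The continuous extension to `L²(ℝⁿ; F)` of an `L²`-bounded operator on `𝓢(ℝⁿ; F)`. -/
noncomputable def l2Extension (A : Module.End ℂ 𝓢(Rn n, F)) :
    Lp F 2 (volume : Measure (Rn n)) →L[ℂ] Lp F 2 (volume : Measure (Rn n)) :=
  ((SchwartzMap.toLpCLM ℂ F 2 (volume : Measure (Rn n))).toLinearMap ∘ₗ A).extendOfNorm
    (SchwartzMap.toLpCLM ℂ F 2 (volume : Measure (Rn n))).toLinearMap

/-- An operator on `𝓢(ℝⁿ; F)` extends to a trace-class operator on `L²(ℝⁿ; F)`. -/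
def IsTraceClassOnL2 (A : Module.End ℂ 𝓢(Rn n, F)) : Prop :=
  IsL2Bounded A ∧ IsTraceClass (l2Extension A)

/-- The trace of (the extension to) `L²(ℝⁿ; F)`. -/
noncomputable def l2Trace (A : Module.End ℂ 𝓢(Rn n, F)) : ℂ := hilbertTrace (l2Extension A)

end L2

/-! ### The action of `g ∈ SO(n)` -/

/-- The action of an element of a subgroup of `SO(n)` on `ℝⁿ`. -/
noncomputable def act {n : ℕ} {G : Subgroup (Matrix.specialOrthogonalGroup (Fin n) ℝ)} (g : G) :
    Rn n →L[ℝ] Rn n :=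
  Matrix.toEuclideanCLM (n := Fin n) (𝕜 := ℝ)
    ((g : Matrix.specialOrthogonalGroup (Fin n) ℝ) : Matrix (Fin n) (Fin n) ℝ)

theorem act_mul_act_inv {n : ℕ} {G : Subgroup (Matrix.specialOrthogonalGroup (Fin n) ℝ)}
    (g : G) : act g * act g⁻¹ = 1 := by
  rw [act, act, ← map_mul, ← Submonoid.coe_mul, ← Subgroup.coe_mul, mul_inv_cancel]
  simp

theorem act_inv_act {n : ℕ} {G : Subgroup (Matrix.specialOrthogonalGroup (Fin n) ℝ)}
    (g : G) (x : Rn n) : act g⁻¹ (act g x) = x := by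
  have h := act_mul_act_inv g⁻¹
  rw [inv_inv] at h
  exact DFunLike.congr_fun h x

theorem act_act_inv {n : ℕ} {G : Subgroup (Matrix.specialOrthogonalGroup (Fin n) ℝ)}
    (g : G) (x : Rn n) : act g (act g⁻¹ x) = x :=
  DFunLike.congr_fun (act_mul_act_inv g) x

/-- The action on `ℝⁿ` as a linear equivalence. -/
noncomputable def actEquiv {n : ℕ} {G : Subgroup (Matrix.specialOrthogonalGroup (Fin n) ℝ)}
    (g : G) : Rn n ≃L[ℝ] Rn n :=
  ContinuousLinearEquiv.equivOfInverse (act g) (act g⁻¹) (act_inv_act g) (act_act_inv g)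

/-- The fixed-point set `(ℝⁿ)^g`. -/
noncomputable def fixedSpace {n : ℕ} {G : Subgroup (Matrix.specialOrthogonalGroup (Fin n) ℝ)}
    (g : G) : Submodule ℝ (Rn n) :=
  LinearMap.eqLocus (act g).toLinearMap LinearMap.id

theorem mem_fixedSpace {n : ℕ} {G : Subgroup (Matrix.specialOrthogonalGroup (Fin n) ℝ)}
    (g : G) (x : Rn n) : x ∈ fixedSpace g ↔ act g x = x := Iff.rfl

theorem inner_act_act {n : ℕ} {G : Subgroup (Matrix.specialOrthogonalGroup (Fin n) ℝ)}
    (g : G) (x y : Rn n) : inner ℝ (act g x) (act g y) = inner ℝ x y := by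
  have h : star (((g : Matrix.specialOrthogonalGroup (Fin n) ℝ) : Matrix (Fin n) (Fin n) ℝ)) *
      ((g : Matrix.specialOrthogonalGroup (Fin n) ℝ) : Matrix (Fin n) (Fin n) ℝ) = 1 :=
    (Matrix.mem_orthogonalGroup_iff' (Fin n) ℝ).1 (Matrix.mem_specialOrthogonalGroup_iff.1
      (g : Matrix.specialOrthogonalGroup (Fin n) ℝ).2).1
  rw [← ContinuousLinearMap.adjoint_inner_right, ← ContinuousLinearMap.star_eq_adjoint]
  have h2 : star (act g) * act g = 1 := by
    rw [act, ← map_star, ← map_mul, h, map_one]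
  have h3 : (star (act g)) (act g y) = y := DFunLike.congr_fun h2 y
  rw [h3]

theorem act_sub_one_mem_normal {n : ℕ}
    {G : Subgroup (Matrix.specialOrthogonalGroup (Fin n) ℝ)} (g : G) :
    ∀ v ∈ (fixedSpace g)ᗮ,
      ((act g).toLinearMap - LinearMap.id : Rn n →ₗ[ℝ] Rn n) v ∈ (fixedSpace g)ᗮ := by
  intro v hv
  rw [Submodule.mem_orthogonal] at hv ⊢
  intro u hu
  have h1 := inner_act_act g u v
  rw [(mem_fixedSpace g u).1 hu] at h1
  change inner ℝ u (act g v - v) = 0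
  rw [inner_sub_right, h1, sub_self]

/-- `det(g - 1)`: the determinant of `g - 1` on the orthogonal complement of `(ℝⁿ)^g`. -/
noncomputable def detNormal {n : ℕ} {G : Subgroup (Matrix.specialOrthogonalGroup (Fin n) ℝ)}
    (g : G) : ℝ :=
  LinearMap.det (((act g).toLinearMap - LinearMap.id : Rn n →ₗ[ℝ] Rn n).restrict (act_sub_one_mem_normal g))

/-- The operator `(ĝ φ)(x) = γ (φ (g⁻¹ x))` on `𝓢(ℝⁿ; F)`, where `γ` is the matrix by which `g`
acts on the fibre `F`. -/
noncomputable def hatAction {n : ℕ} {F : Type*} [NormedAddCommGroup F] [NormedSpace ℂ F]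
    {G : Subgroup (Matrix.specialOrthogonalGroup (Fin n) ℝ)} (g : G) (γ : F →L[ℂ] F) :
    Module.End ℂ 𝓢(Rn n, F) :=
  (SchwartzMap.postcompCLM γ ∘L
    SchwartzMap.compCLMOfContinuousLinearEquiv ℂ (actEquiv g).symm).toLinearMap

theorem hatAction_apply {n : ℕ} {F : Type*} [NormedAddCommGroup F] [NormedSpace ℂ F]
    {G : Subgroup (Matrix.specialOrthogonalGroup (Fin n) ℝ)} (g : G) (γ : F →L[ℂ] F)
    (φ : 𝓢(Rn n, F)) (x : Rn n) : hatAction g γ φ x = γ (φ (act g⁻¹ x)) := rfl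

/-! ### The cocycle `ω_g` -/

/-- Multiplication by the linear coordinate `x ↦ ⟨e, x⟩`. -/
noncomputable def coordMul {n : ℕ} {F : Type*} [NormedAddCommGroup F] [NormedSpace ℂ F]
    (e : Rn n) : Module.End ℂ 𝓢(Rn n, F) :=
  (SchwartzMap.smulLeftCLM F (fun x : Rn n => ((inner ℝ e x : ℝ) : ℂ))).toLinearMap

theorem coordMul_apply {n : ℕ} {F : Type*} [NormedAddCommGroup F] [NormedSpace ℂ F]
    (e : Rn n) (φ : 𝓢(Rn n, F)) (x : Rn n) :
    coordMul e φ x = ((inner ℝ e x : ℝ) : ℂ) • φ x := by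
  have h : Function.HasTemperateGrowth (fun x : Rn n => ((inner ℝ e x : ℝ) : ℂ)) :=
    ContinuousLinearMap.hasTemperateGrowth (Complex.ofRealCLM ∘L (innerSL ℝ e : Rn n →L[ℝ] ℝ))
  exact SchwartzMap.smulLeftCLM_apply_apply h φ x

/-- For orthonormal coordinate directions `e₁, …, e_d`, the operators
`∂_{x₁}, x₁, ∂_{x₂}, x₂, …, ∂_{x_d}, x_d` (in this order) on `𝓢(ℝⁿ; F)`. -/
noncomputable def derivGenerator {n d : ℕ} {F : Type*} [NormedAddCommGroup F] [NormedSpace ℂ F]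
    (e : Fin d → Rn n) (m : Fin (2 * d)) : Module.End ℂ 𝓢(Rn n, F) :=
  if m.val % 2 = 0 then
    (LineDeriv.lineDerivOpCLM ℂ 𝓢(Rn n, F) (e ⟨m.val / 2, by omega⟩)).toLinearMap
  else coordMul (e ⟨m.val / 2, by omega⟩)

/-- The operator `ĝ T₀ δ_{σ(1)}(T₁) ⋯ δ_{σ(2d)}(T_{2d})`, where `δ_m` is the commutator with the
`m`-th operator in the list `∂_{x₁}, x₁, …, ∂_{x_d}, x_d`. -/
noncomputable def omegaTerm {n d : ℕ} {F : Type*} [NormedAddCommGroup F] [NormedSpace ℂ F]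
    {G : Subgroup (Matrix.specialOrthogonalGroup (Fin n) ℝ)} (g : G) (γ : F →L[ℂ] F)
    (e : Fin d → Rn n) (T : Fin (2 * d + 1) → Module.End ℂ 𝓢(Rn n, F))
    (σ : Equiv.Perm (Fin (2 * d))) : Module.End ℂ 𝓢(Rn n, F) :=
  hatAction g γ * T 0 *
    (List.ofFn fun i : Fin (2 * d) => ⁅derivGenerator (F := F) e (σ i), T i.succ⁆).prod

/-- `ω_g(T₀, …, T_{2d}) = ((-1)^d / d!) ∑_σ sgn(σ) Tr(ĝ T₀ δ_{σ(1)}(T₁) ⋯ δ_{σ(2d)}(T_{2d}))`. -/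
noncomputable def omega {n d : ℕ} {F : Type*} [NormedAddCommGroup F] [InnerProductSpace ℂ F]
    [CompleteSpace F] {G : Subgroup (Matrix.specialOrthogonalGroup (Fin n) ℝ)} (g : G)
    (γ : F →L[ℂ] F) (e : Fin d → Rn n) (T : Fin (2 * d + 1) → Module.End ℂ 𝓢(Rn n, F)) : ℂ :=
  (-1) ^ d / (d.factorial : ℂ) *
    ∑ σ : Equiv.Perm (Fin (2 * d)), ((Equiv.Perm.sign σ : ℤ) : ℂ) * l2Trace (omegaTerm g γ e T σ)

/-! ### The cocycle `ε_g` -/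

/-- The value on the vectors `v₁, …, v_m` of the wedge product `α₁ ∧ ⋯ ∧ α_m` of one-forms with
values in an algebra `A`: `∑_σ sgn(σ) α₁(v_{σ(1)}) ⋯ α_m(v_{σ(m)})`. -/
noncomputable def wedgeEval {m : ℕ} {X A : Type*} [Ring A] (α : Fin m → X → A) (v : Fin m → X) :
    A :=
  ∑ σ : Equiv.Perm (Fin m), (Equiv.Perm.sign σ : ℤ) • (List.ofFn fun i => α i (v (σ i))).prod

/-- The frame `∂_{x₁}, ∂_{ξ₁}, …, ∂_{x_d}, ∂_{ξ_d}` of `T*ℝᵈ`, positively oriented for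
`dx₁ ∧ dξ₁ ∧ ⋯ ∧ dx_d ∧ dξ_d`. -/
noncomputable def cotangentFrame (d : ℕ) (m : Fin (2 * d)) : Rn d × Rn d :=
  if m.val % 2 = 0 then (EuclideanSpace.single ⟨m.val / 2, by omega⟩ 1, 0)
  else (0, EuclideanSpace.single ⟨m.val / 2, by omega⟩ 1)

/-- The restriction of a function on `T*ℝⁿ` to `T*(ℝⁿ)^g = (ℝⁿ)^g × (ℝⁿ)^g`, in the coordinates
given by an orthonormal basis of `(ℝⁿ)^g`. -/
noncomputable def restrictFixed {n d : ℕ} {A : Type*}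
    {G : Subgroup (Matrix.specialOrthogonalGroup (Fin n) ℝ)} {g : G}
    (b : OrthonormalBasis (Fin d) ℝ (fixedSpace g)) (f : Rn n × Rn n → A) (p : Rn d × Rn d) : A :=
  f ((b.repr.symm p.1 : Rn n), (b.repr.symm p.2 : Rn n))

/-- The top-degree form `tr[γ f₀ df₁ ⋯ df_{2d}]` on `T*(ℝⁿ)^g`, written as a function times
`dx₁ ∧ dξ₁ ∧ ⋯ ∧ dx_d ∧ dξ_d`. -/
noncomputable def epsilonDensity {n d : ℕ} {F : Type*} [NormedAddCommGroup F] [NormedSpace ℂ F]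
    {G : Subgroup (Matrix.specialOrthogonalGroup (Fin n) ℝ)} {g : G} (γ : F →L[ℂ] F)
    (b : OrthonormalBasis (Fin d) ℝ (fixedSpace g))
    (f : Fin (2 * d + 1) → 𝓢(Rn n × Rn n, F →L[ℂ] F)) (p : Rn d × Rn d) : ℂ :=
  LinearMap.trace ℂ F (γ * (restrictFixed b (f 0) p *
    wedgeEval (fun i : Fin (2 * d) => ⇑(fderiv ℝ (restrictFixed b (f i.succ)) p))
      (cotangentFrame d))).toLinearMap

/-- `ε_g(f₀, …, f_{2d}) = (1 / ((2πi)^d d! det(g-1))) ∫_{T*(ℝⁿ)^g} tr[γ f₀ df₁ ⋯ df_{2d}]`. -/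
noncomputable def epsilon {n d : ℕ} {F : Type*} [NormedAddCommGroup F] [NormedSpace ℂ F]
    {G : Subgroup (Matrix.specialOrthogonalGroup (Fin n) ℝ)} {g : G} (γ : F →L[ℂ] F)
    (b : OrthonormalBasis (Fin d) ℝ (fixedSpace g))
    (f : Fin (2 * d + 1) → 𝓢(Rn n × Rn n, F →L[ℂ] F)) : ℂ :=
  1 / ((2 * Real.pi * Complex.I) ^ d * (d.factorial : ℂ) * (detNormal g : ℂ)) *
    ∫ p, epsilonDensity γ b f p

/-! ### The fibre `V ⊕ W` -/

/-- The fibre `V ⊕ W` (orthogonal sum) with `V = ℂᵏ`, `W = ℂˡ`. -/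
abbrev Fibre (k l : ℕ) := WithLp 2 (EuclideanSpace ℂ (Fin k) × EuclideanSpace ℂ (Fin l))

/-- The block-diagonal endomorphism `diag(A, B)` of `V ⊕ W`. -/
noncomputable def blockDiag {k l : ℕ} (A : EuclideanSpace ℂ (Fin k) →ₗ[ℂ] EuclideanSpace ℂ (Fin k))
    (B : EuclideanSpace ℂ (Fin l) →ₗ[ℂ] EuclideanSpace ℂ (Fin l)) :
    Fibre k l →L[ℂ] Fibre k l :=
  (WithLp.prodContinuousLinearEquiv 2 ℂ (EuclideanSpace ℂ (Fin k))
      (EuclideanSpace ℂ (Fin l))).symm.toContinuousLinearMap ∘L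
    (LinearMap.toContinuousLinearMap A).prodMap (LinearMap.toContinuousLinearMap B) ∘L
    (WithLp.prodContinuousLinearEquiv 2 ℂ (EuclideanSpace ℂ (Fin k))
      (EuclideanSpace ℂ (Fin l))).toContinuousLinearMap

theorem blockDiag_apply {k l : ℕ} (A : EuclideanSpace ℂ (Fin k) →ₗ[ℂ] EuclideanSpace ℂ (Fin k))
    (B : EuclideanSpace ℂ (Fin l) →ₗ[ℂ] EuclideanSpace ℂ (Fin l))
    (v : EuclideanSpace ℂ (Fin k)) (w : EuclideanSpace ℂ (Fin l)) :
    blockDiag A B (WithLp.toLp 2 (v, w)) = WithLp.toLp 2 (A v, B w) := rfl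

end EquivariantIndex

open EquivariantIndex

namespace EquivariantIndex

section HilbertSchmidt

variable {X H ι : Type*} [MeasurableSpace X] {μ : Measure X} [NormedAddCommGroup H]
  [InnerProductSpace ℂ H]

/-- The rows of a Hilbert–Schmidt operator have square-summable coefficients. -/
theorem integrable_sq_norm_inner {a : X → H} {w : X → ℝ}
    (ha : ∀ e, AEStronglyMeasurable (fun x => inner ℂ (a x) e) μ)
    (hw : Integrable (fun x => w x ^ 2) μ) (haw : ∀ x, ‖a x‖ ≤ w x) (e : H) :
    Integrable (fun x => ‖inner ℂ (a x) e‖ ^ 2) μ := by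
  refine (hw.mul_const (‖e‖ ^ 2)).mono' ((ha e).norm.pow 2) (ae_of_all _ fun x => ?_)
  rw [Real.norm_of_nonneg (by positivity), ← mul_pow]
  gcongr
  exact (norm_inner_le_norm _ _).trans (by gcongr; exact haw x)

theorem summable_integral_sq_norm_inner {a : X → H} {w : X → ℝ}
    (ha : ∀ e, AEStronglyMeasurable (fun x => inner ℂ (a x) e) μ)
    (hw : Integrable (fun x => w x ^ 2) μ) (haw : ∀ x, ‖a x‖ ≤ w x)
    {e : ι → H} (he : Orthonormal ℂ e) :
    Summable fun i => ∫ x, ‖inner ℂ (a x) (e i)‖ ^ 2 ∂μ := by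
  refine summable_of_sum_le (c := ∫ x, w x ^ 2 ∂μ) (fun i => by positivity) fun s => ?_
  rw [← integral_finsetSum _ fun i _ => integrable_sq_norm_inner ha hw haw (e i)]
  refine integral_mono (integrable_finsetSum _ fun i _ => integrable_sq_norm_inner ha hw haw (e i))
    hw fun x => ?_
  have h := he.sum_inner_products_le (x := a x) (s := s)
  simp only [fun i => norm_inner_symm (𝕜 := ℂ) (a x) (e i)]
  exact h.trans (by gcongr; exact haw x)

/-- The trace of an operator given weakly as a superposition of rank-one operators. -/
theorem hasSum_inner_of_weak_rank_one [Countable ι] {κ : Type*} [Fintype κ]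
    (b : HilbertBasis ι ℂ H) {T : H →L[ℂ] H} {p q : κ → X → H} {w : X → ℝ}
    (hp : ∀ α e, AEStronglyMeasurable (fun x => inner ℂ (p α x) e) μ)
    (hq : ∀ α e, AEStronglyMeasurable (fun x => inner ℂ (q α x) e) μ)
    (hw : Integrable (fun x => w x ^ 2) μ) (hpw : ∀ α x, ‖p α x‖ ≤ w x)
    (hqw : ∀ α x, ‖q α x‖ ≤ w x)
    (hT : ∀ e, inner ℂ e (T e) =
      ∑ α, ∫ x, inner ℂ (q α x) e * inner ℂ e (p α x) ∂μ) :
    HasSum (fun i => inner ℂ (b i) (T (b i))) (∑ α, ∫ x, inner ℂ (q α x) (p α x) ∂μ) := by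
  simp_rw [hT]
  refine hasSum_sum fun α _ => ?_
  have hp' : ∀ e, AEStronglyMeasurable (fun x => inner ℂ e (p α x)) μ := fun e => by
    simpa using (RCLike.continuous_conj (K := ℂ)).comp_aestronglyMeasurable (hp α e)
  have hle : ∀ i x, ‖inner ℂ (q α x) (b i) * inner ℂ (b i) (p α x)‖ ≤
      ‖inner ℂ (q α x) (b i)‖ ^ 2 + ‖inner ℂ (p α x) (b i)‖ ^ 2 := fun i x => by
    rw [norm_mul, norm_inner_symm (b i)]
    nlinarith [sq_nonneg (‖inner ℂ (q α x) (b i)‖ - ‖inner ℂ (p α x) (b i)‖),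
      sq_nonneg (‖inner ℂ (q α x) (b i)‖), sq_nonneg ‖inner ℂ (p α x) (b i)‖]
  have hbi := fun i => (integrable_sq_norm_inner (hq α) hw (hqw α) (b i)).add
    (integrable_sq_norm_inner (hp α) hw (hpw α) (b i))
  have hint : ∀ i, Integrable (fun x => inner ℂ (q α x) (b i) * inner ℂ (b i) (p α x)) μ :=
    fun i => (hbi i).mono' ((hq α _).mul (hp' _)) (ae_of_all _ (hle i))
  have hs : Summable fun i => ∫ x, ‖inner ℂ (q α x) (b i) * inner ℂ (b i) (p α x)‖ ∂μ := by
    refine Summable.of_nonneg_of_le (fun i => by positivity) (fun i => ?_)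
      ((summable_integral_sq_norm_inner (hq α) hw (hqw α) b.orthonormal).add
        (summable_integral_sq_norm_inner (hp α) hw (hpw α) b.orthonormal))
    rw [← integral_add (integrable_sq_norm_inner (hq α) hw (hqw α) (b i))
      (integrable_sq_norm_inner (hp α) hw (hpw α) (b i))]
    exact integral_mono (hint i).norm (hbi i) (hle i)
  have h := hasSum_integral_of_summable_integral_norm hint hs
  simp_rw [b.tsum_inner_mul_inner] at h
  exact h

theorem countable_of_orthonormal [TopologicalSpace.SeparableSpace H] {e : ι → H}
    (he : Orthonormal ℂ e) : Countable ι := by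
  refine Pairwise.countable_of_isOpen_disjoint (s := fun i => Metric.ball (e i) (1 / 2)) ?_
    (fun _ => Metric.isOpen_ball) fun i => ⟨e i, Metric.mem_ball_self (by norm_num)⟩
  intro i j hij
  refine Metric.ball_disjoint_ball ?_
  have h : dist (e i) (e j) ^ 2 = 2 := by
    rw [dist_eq_norm, @norm_sub_sq ℂ, he.1 i, he.1 j, he.2 hij]
    norm_num
  nlinarith [dist_nonneg (x := e i) (y := e j)]

theorem isTraceClass_of_hasSum [Countable ι] {T : H →L[ℂ] H} {u v : ι → H}
    (huv : Summable fun i => ‖u i‖ * ‖v i‖)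
    (hT : ∀ φ, HasSum (fun i => inner ℂ (u i) φ • v i) (T φ)) : IsTraceClass T := by
  obtain ⟨j, hj⟩ := exists_injective_nat ι
  refine ⟨Function.extend j u 0, Function.extend j v 0, ?_, fun φ => ?_⟩
  · rw [← hj.summable_iff]
    · simpa [Function.comp_def, hj.extend_apply] using huv
    · intro x hx
      simp [Function.extend_apply' _ _ _ hx]
  · rw [← hj.hasSum_iff]
    · simpa [Function.comp_def, hj.extend_apply] using hT φ
    · intro x hx
      simp [Function.extend_apply' _ _ _ hx]

theorem hasSum_sq_norm_inner (b : HilbertBasis ι ℂ H) (y : H) :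
    HasSum (fun i => ‖inner ℂ (b i) y‖ ^ 2) (‖y‖ ^ 2) := by
  have h := (b.hasSum_inner_mul_inner y y).mapL Complex.reCLM
  convert! h using 1
  · funext i
    have h2 := inner_mul_symm_re_eq_norm (𝕜 := ℂ) y (b i)
    rw [norm_mul, norm_inner_symm, ← sq] at h2
    exact h2.symm
  · rw [Complex.reCLM_apply, ← inner_self_eq_norm_sq (𝕜 := ℂ)]
    rfl

theorem summable_sq_norm_adjoint [CompleteSpace H] (b : HilbertBasis ι ℂ H)
    {B : H →L[ℂ] H} (hB : Summable fun i => ‖B (b i)‖ ^ 2) :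
    Summable fun i => ‖B.adjoint (b i)‖ ^ 2 := by
  have h2 : Summable fun p : ι × ι => ‖inner ℂ (b p.2) (B (b p.1))‖ ^ 2 := by
    rw [summable_prod_of_nonneg (fun p => by positivity)]
    refine ⟨fun i => (hasSum_sq_norm_inner b (B (b i))).summable, hB.congr fun i => ?_⟩
    exact (hasSum_sq_norm_inner b (B (b i))).tsum_eq.symm
  have h3 : Summable fun p : ι × ι => ‖inner ℂ (b p.1) (B (b p.2))‖ ^ 2 := h2.prod_symm
  rw [summable_prod_of_nonneg (fun p => by positivity)] at h3
  refine h3.2.congr fun i => ?_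
  rw [← (hasSum_sq_norm_inner b (B.adjoint (b i))).tsum_eq]
  refine tsum_congr fun j => ?_
  rw [ContinuousLinearMap.adjoint_inner_right, norm_inner_symm]

/-- The product of two Hilbert–Schmidt operators is trace class. -/
theorem IsTraceClass.mul_of_summable_sq [CompleteSpace H] [Countable ι] (b : HilbertBasis ι ℂ H)
    {A B : H →L[ℂ] H} (hA : Summable fun i => ‖A (b i)‖ ^ 2)
    (hB : Summable fun i => ‖B (b i)‖ ^ 2) : IsTraceClass (A ∘L B) := by
  have hB' := summable_sq_norm_adjoint b hB
  refine isTraceClass_of_hasSum (u := fun i => B.adjoint (b i)) (v := fun i => A (b i)) ?_ ?_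
  · refine Summable.of_nonneg_of_le (fun i => by positivity) (fun i => ?_) (hA.add hB')
    nlinarith [sq_nonneg (‖A (b i)‖ - ‖B.adjoint (b i)‖), sq_nonneg ‖A (b i)‖,
      sq_nonneg ‖B.adjoint (b i)‖]
  · intro φ
    have h := (b.hasSum_repr (B φ)).mapL A
    simpa [b.repr_apply_apply, ContinuousLinearMap.adjoint_inner_left] using h

end HilbertSchmidt

section Weight

variable {V : Type*} [NormedAddCommGroup V]

/-- The polynomially decaying weight `(1 + ‖x‖)⁻ᴺ`. -/
noncomputable def decayWeight (N : ℕ) (x : V) : ℝ := ((1 + ‖x‖) ^ N)⁻¹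

theorem decayWeight_pos (N : ℕ) (x : V) : 0 < decayWeight N x := by
  unfold decayWeight; positivity

theorem decayWeight_nonneg (N : ℕ) (x : V) : 0 ≤ decayWeight N x := (decayWeight_pos N x).le

theorem decayWeight_le_one (N : ℕ) (x : V) : decayWeight N x ≤ 1 :=
  inv_le_one_of_one_le₀ (one_le_pow₀ (by linarith [norm_nonneg x]))

theorem decayWeight_add_exponent (N M : ℕ) (x : V) :
    decayWeight (N + M) x = decayWeight N x * decayWeight M x := by
  simp [decayWeight, pow_add, mul_comm]

theorem decayWeight_anti {N M : ℕ} (h : N ≤ M) (x : V) : decayWeight M x ≤ decayWeight N x := by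
  unfold decayWeight
  gcongr
  linarith [norm_nonneg x]

theorem decayWeight_mul_le (N : ℕ) (x y : V) :
    decayWeight N x * decayWeight N y ≤ decayWeight N (x + y) := by
  unfold decayWeight
  rw [← mul_inv, ← mul_pow]
  gcongr
  nlinarith [norm_add_le x y, mul_nonneg (norm_nonneg x) (norm_nonneg y)]

theorem decayWeight_le_of_norm_le {V' : Type*} [NormedAddCommGroup V'] (N : ℕ) {x : V} {y : V'}
    (h : ‖y‖ ≤ ‖x‖) : decayWeight N x ≤ decayWeight N y := by
  unfold decayWeight
  gcongr

@[fun_prop]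
theorem continuous_decayWeight (N : ℕ) : Continuous (decayWeight N : V → ℝ) := by
  unfold decayWeight
  refine Continuous.inv₀ (by fun_prop) fun x => by positivity

variable [NormedSpace ℝ V] [FiniteDimensional ℝ V] [MeasurableSpace V] [BorelSpace V]

theorem integrable_decayWeight {N : ℕ} (h : Module.finrank ℝ V < N)
    (μ : Measure V) [μ.IsAddHaarMeasure] : Integrable (decayWeight N : V → ℝ) μ := by
  have := integrable_one_add_norm (E := V) (μ := μ) (r := N) (by exact_mod_cast h)
  refine this.congr (ae_of_all _ fun x => ?_)
  simp only [decayWeight]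
  rw [Real.rpow_neg (by positivity), Real.rpow_natCast]

theorem integrable_decayWeight_sq {N : ℕ} (h : Module.finrank ℝ V < N)
    (μ : Measure V) [μ.IsAddHaarMeasure] :
    Integrable (fun x : V => decayWeight N x ^ 2) μ := by
  refine (integrable_decayWeight h μ).mono' (by fun_prop) (ae_of_all _ fun x => ?_)
  rw [Real.norm_of_nonneg (by positivity)]
  nlinarith [decayWeight_nonneg N x, decayWeight_le_one N x]

theorem memLp_decayWeight {N : ℕ} (h : Module.finrank ℝ V < N)
    (μ : Measure V) [μ.IsAddHaarMeasure] : MemLp (decayWeight N : V → ℝ) 2 μ :=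
  (memLp_two_iff_integrable_sq (by fun_prop)).2 (integrable_decayWeight_sq h μ)

end Weight

section Kernel

variable {n : ℕ} {F : Type*} [NormedAddCommGroup F] [InnerProductSpace ℂ F]

/-- Continuous operator-valued integral kernels with polynomial decay strong enough to be
integrable and square-integrable. -/
structure IsDecayingKernel (K : Rn n → Rn n → F →L[ℂ] F) : Prop where
  cont : Continuous fun p : Rn n × Rn n => K p.1 p.2
  bound : ∃ C, ∀ x z, ‖K x z‖ ≤ C * (decayWeight (n + 1) x * decayWeight (n + 1) z)

namespace IsDecayingKernel

variable {K : Rn n → Rn n → F →L[ℂ] F}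

theorem exists_bound (hK : IsDecayingKernel K) :
    ∃ C, 0 ≤ C ∧ ∀ x z, ‖K x z‖ ≤ C * (decayWeight (n + 1) x * decayWeight (n + 1) z) := by
  obtain ⟨C, hC⟩ := hK.bound
  refine ⟨|C|, abs_nonneg C, fun x z => (hC x z).trans ?_⟩
  have := decayWeight_nonneg (n + 1) x
  have := decayWeight_nonneg (n + 1) z
  gcongr
  exact le_abs_self C

theorem swap (hK : IsDecayingKernel K) : IsDecayingKernel fun x z => K z x := by
  obtain ⟨C, hC⟩ := hK.bound
  exact ⟨hK.cont.comp continuous_swap, C, fun x z => (hC z x).trans_eq (by ring)⟩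

theorem adjoint [CompleteSpace F] (hK : IsDecayingKernel K) :
    IsDecayingKernel fun x z => (K x z).adjoint := by
  obtain ⟨C, hC⟩ := hK.bound
  exact ⟨(LinearIsometryEquiv.continuous _).comp hK.cont, C, fun x z => by simpa using hC x z⟩

end IsDecayingKernel

theorem finrank_Rn_lt (n : ℕ) : Module.finrank ℝ (Rn n) < n + 1 := by simp

namespace IsDecayingKernel

variable {K : Rn n → Rn n → F →L[ℂ] F}

theorem memLp_apply (hK : IsDecayingKernel K) (v : F) (x : Rn n) :
    MemLp (fun z => K x z v) 2 := by
  obtain ⟨C, h0, hC⟩ := hK.exists_bound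
  have := hK.cont
  refine ((memLp_decayWeight (finrank_Rn_lt n) volume).const_mul
    (C * ‖v‖)).of_le (by fun_prop) (ae_of_all _ fun z => ?_)
  have h1 := decayWeight_nonneg (n + 1) z
  rw [Real.norm_of_nonneg (by positivity)]
  refine ((K x z).le_opNorm v).trans ?_
  calc ‖K x z‖ * ‖v‖ ≤ (C * (1 * decayWeight (n + 1) z)) * ‖v‖ := by
        refine mul_le_mul_of_nonneg_right ((hC x z).trans ?_) (norm_nonneg v)
        gcongr
        exact decayWeight_le_one _ _
    _ = _ := by ring

/-- The rows of a kernel applied to a vector, as `L²` functions. -/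
noncomputable def row (hK : IsDecayingKernel K) (v : F) (x : Rn n) :
    Lp F 2 (volume : Measure (Rn n)) := (hK.memLp_apply v x).toLp

theorem inner_row (hK : IsDecayingKernel K) (v : F) (x : Rn n)
    (e : Lp F 2 (volume : Measure (Rn n))) :
    inner ℂ (hK.row v x) e = ∫ z, inner ℂ (K x z v) (e z) := by
  rw [L2.inner_def]
  refine integral_congr_ae ?_
  filter_upwards [(hK.memLp_apply v x).coeFn_toLp] with z hz
  rw [row, hz]

theorem norm_row_le (hK : IsDecayingKernel K) (v : F) :
    ∃ D, 0 ≤ D ∧ ∀ x, ‖hK.row v x‖ ≤ D * decayWeight (n + 1) x := by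
  obtain ⟨C, h0, hC⟩ := hK.exists_bound
  have hw := memLp_decayWeight (finrank_Rn_lt n) (volume : Measure (Rn n))
  refine ⟨C * ‖v‖ * ‖hw.toLp‖, by positivity, fun x => ?_⟩
  have h1 := decayWeight_nonneg (n + 1) x
  have := Lp.norm_le_mul_norm_of_ae_le_mul (c := C * ‖v‖ * decayWeight (n + 1) x)
    (f := hK.row v x) (g := hw.toLp) ?_
  · linarith
  · filter_upwards [(hK.memLp_apply v x).coeFn_toLp, hw.coeFn_toLp] with z hz hz'
    rw [row, hz, hz', Real.norm_of_nonneg (decayWeight_nonneg _ _)]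
    refine ((K x z).le_opNorm v).trans ?_
    calc ‖K x z‖ * ‖v‖ ≤ (C * (decayWeight (n + 1) x * decayWeight (n + 1) z)) * ‖v‖ :=
          mul_le_mul_of_nonneg_right (hC x z) (norm_nonneg v)
      _ = _ := by ring

theorem aestronglyMeasurable_inner_row (hK : IsDecayingKernel K) (v : F)
    (e : Lp F 2 (volume : Measure (Rn n))) :
    AEStronglyMeasurable (fun x => inner ℂ (hK.row v x) e) volume := by
  simp_rw [hK.inner_row]
  have hc : Continuous fun p : Rn n × Rn n => K p.1 p.2 v := by have := hK.cont; fun_prop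
  exact AEStronglyMeasurable.integral_prod_right'
    (f := fun p : Rn n × Rn n => inner ℂ (K p.1 p.2 v) (e p.2))
    (hc.aestronglyMeasurable.inner (Lp.aestronglyMeasurable e).comp_snd)

theorem integrable_weight_mul_norm (e : Lp F 2 (volume : Measure (Rn n))) :
    Integrable fun z => decayWeight (n + 1) z * ‖e z‖ :=
  (memLp_decayWeight (finrank_Rn_lt n) volume).integrable_mul (Lp.memLp e).norm

theorem integrable_apply (hK : IsDecayingKernel K) (x : Rn n)
    (e : Lp F 2 (volume : Measure (Rn n))) : Integrable fun z => K x z (e z) := by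
  obtain ⟨C, h0, hC⟩ := hK.exists_bound
  have hc := hK.cont
  refine ((integrable_weight_mul_norm e).const_mul C).mono' ?_ (ae_of_all _ fun z => ?_)
  · have h1 : AEStronglyMeasurable (fun z => K x z) volume :=
      Continuous.aestronglyMeasurable (by fun_prop)
    exact isBoundedBilinearMap_apply.continuous.comp_aestronglyMeasurable
      (h1.prodMk (Lp.aestronglyMeasurable e))
  · refine ((K x z).le_opNorm _).trans ?_
    have h1 := decayWeight_nonneg (n + 1) z
    calc ‖K x z‖ * ‖e z‖ ≤ (C * (1 * decayWeight (n + 1) z)) * ‖e z‖ := by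
          refine mul_le_mul_of_nonneg_right ((hC x z).trans ?_) (norm_nonneg _)
          gcongr
          exact decayWeight_le_one _ _
      _ = _ := by ring

theorem inner_integral_apply [CompleteSpace F] (hK : IsDecayingKernel K) (v : F) (x : Rn n)
    (e : Lp F 2 (volume : Measure (Rn n))) :
    inner ℂ v (∫ z, K x z (e z)) = inner ℂ (hK.adjoint.row v x) e := by
  rw [inner_row, ← integral_inner (hK.integrable_apply x e)]
  simp_rw [ContinuousLinearMap.adjoint_inner_left]

theorem norm_integral_apply_le (hK : IsDecayingKernel K) :
    ∃ D, 0 ≤ D ∧ ∀ (e : Lp F 2 (volume : Measure (Rn n))) x,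
      ‖∫ z, K x z (e z)‖ ≤ D * ‖e‖ * decayWeight (n + 1) x := by
  obtain ⟨C, h0, hC⟩ := hK.exists_bound
  have hw := memLp_decayWeight (finrank_Rn_lt n) (volume : Measure (Rn n))
  refine ⟨C * ‖hw.toLp‖, by positivity, fun e x => ?_⟩
  have h1 := decayWeight_nonneg (n + 1) x
  have h2 : ∫ z, decayWeight (n + 1) z * ‖e z‖ ≤ ‖hw.toLp‖ * ‖e‖ := by
    have he := (Lp.memLp e).norm
    have h3 : ‖he.toLp‖ = ‖e‖ := by
      rw [Lp.norm_toLp, Lp.norm_def, eLpNorm_norm]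
    rw [← h3]
    refine le_trans (le_of_eq ?_) (real_inner_le_norm hw.toLp he.toLp)
    rw [L2.inner_def]
    refine integral_congr_ae ?_
    filter_upwards [hw.coeFn_toLp, he.coeFn_toLp] with z hz hz'
    rw [hz, hz']
    simp [mul_comm]
  calc ‖∫ z, K x z (e z)‖
      ≤ ∫ z, (C * decayWeight (n + 1) x) * (decayWeight (n + 1) z * ‖e z‖) := by
        refine norm_integral_le_of_norm_le ((integrable_weight_mul_norm e).const_mul _)
          (ae_of_all _ fun z => ?_)
        refine ((K x z).le_opNorm _).trans ?_
        calc _ ≤ (C * (decayWeight (n + 1) x * decayWeight (n + 1) z)) * ‖e z‖ :=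
              mul_le_mul_of_nonneg_right (hC x z) (norm_nonneg _)
          _ = _ := by ring
    _ = (C * decayWeight (n + 1) x) * ∫ z, decayWeight (n + 1) z * ‖e z‖ :=
        integral_const_mul _ _
    _ ≤ (C * decayWeight (n + 1) x) * (‖hw.toLp‖ * ‖e‖) := by gcongr
    _ = _ := by ring

theorem memLp_integral_apply (hK : IsDecayingKernel K) (e : Lp F 2 (volume : Measure (Rn n))) :
    MemLp (fun x => ∫ z, K x z (e z)) 2 := by
  obtain ⟨D, h0, hD⟩ := hK.norm_integral_apply_le
  refine ((memLp_decayWeight (finrank_Rn_lt n) volume).const_mul (D * ‖e‖)).of_le ?_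
    (ae_of_all _ fun x => (hD e x).trans (le_abs_self _))
  exact AEStronglyMeasurable.integral_prod_right'
    (f := fun p : Rn n × Rn n => K p.1 p.2 (e p.2))
    (isBoundedBilinearMap_apply.continuous.comp_aestronglyMeasurable
      (hK.cont.aestronglyMeasurable.prodMk (Lp.aestronglyMeasurable e).comp_snd))

/-- The operator on `L²` with a given kernel. -/
noncomputable def toCLM (hK : IsDecayingKernel K) :
    Lp F 2 (volume : Measure (Rn n)) →L[ℂ] Lp F 2 (volume : Measure (Rn n)) :=
  LinearMap.mkContinuousOfExistsBound
    { toFun := fun e => (hK.memLp_integral_apply e).toLp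
      map_add' := fun e e' => by
        rw [← MemLp.toLp_add]
        refine MemLp.toLp_congr _ _ (ae_of_all _ fun x => ?_)
        simp only [Pi.add_apply]
        rw [← integral_add (hK.integrable_apply x e) (hK.integrable_apply x e')]
        refine integral_congr_ae ?_
        filter_upwards [Lp.coeFn_add e e'] with z hz
        rw [hz, Pi.add_apply, map_add]
      map_smul' := fun c e => by
        rw [RingHom.id_apply, ← MemLp.toLp_const_smul]
        refine MemLp.toLp_congr _ _ (ae_of_all _ fun x => ?_)
        simp only [Pi.smul_apply]
        rw [← integral_smul]
        refine integral_congr_ae ?_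
        filter_upwards [Lp.coeFn_smul c e] with z hz
        rw [hz, Pi.smul_apply, map_smul] }
    (by
      obtain ⟨D, h0, hD⟩ := hK.norm_integral_apply_le
      have hw := memLp_decayWeight (finrank_Rn_lt n) (volume : Measure (Rn n))
      refine ⟨D * ‖hw.toLp‖, fun e => ?_⟩
      have := Lp.norm_le_mul_norm_of_ae_le_mul (c := D * ‖e‖)
        (f := (hK.memLp_integral_apply e).toLp) (g := hw.toLp) (by
          filter_upwards [(hK.memLp_integral_apply e).coeFn_toLp, hw.coeFn_toLp] with x hx hx'
          rw [hx, hx', Real.norm_of_nonneg (decayWeight_nonneg _ _)]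
          exact hD e x)
      exact this.trans_eq (by ring))

theorem toCLM_ae (hK : IsDecayingKernel K) (e : Lp F 2 (volume : Measure (Rn n))) :
    hK.toCLM e =ᵐ[volume] fun x => ∫ z, K x z (e z) :=
  (hK.memLp_integral_apply e).coeFn_toLp

theorem sq_norm_toCLM [CompleteSpace F] {κ : Type*} [Fintype κ] (hK : IsDecayingKernel K)
    (f : OrthonormalBasis κ ℂ F) (e : Lp F 2 (volume : Measure (Rn n))) :
    ‖hK.toCLM e‖ ^ 2 = ∑ α, ∫ x, ‖inner ℂ (hK.adjoint.row (f α) x) e‖ ^ 2 := by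
  have hi : ∀ α, Integrable fun x => ‖inner ℂ (hK.adjoint.row (f α) x) e‖ ^ 2 := fun α => by
    obtain ⟨D, h0, hD⟩ := hK.adjoint.norm_row_le (f α)
    refine integrable_sq_norm_inner (hK.adjoint.aestronglyMeasurable_inner_row (f α))
      (w := fun x => D * decayWeight (n + 1) x) ?_ hD e
    simp_rw [mul_pow]
    exact (integrable_decayWeight_sq (finrank_Rn_lt n) volume).const_mul _
  rw [← integral_finsetSum _ fun α _ => hi α, ← inner_self_eq_norm_sq (𝕜 := ℂ), L2.inner_def,
    ← integral_re]
  · refine integral_congr_ae ?_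
    filter_upwards [hK.toCLM_ae e] with x hx
    rw [hx, inner_self_eq_norm_sq, ← f.sum_sq_norm_inner_right]
    simp_rw [hK.inner_integral_apply]
  · exact L2.integrable_inner (𝕜 := ℂ) _ _

theorem summable_sq_norm_toCLM [CompleteSpace F] [FiniteDimensional ℂ F] {ι : Type*} (hK : IsDecayingKernel K)
    (b : HilbertBasis ι ℂ (Lp F 2 (volume : Measure (Rn n)))) :
    Summable fun i => ‖hK.toCLM (b i)‖ ^ 2 := by
  simp_rw [hK.sq_norm_toCLM (stdOrthonormalBasis ℂ F)]
  refine summable_sum fun α _ => ?_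
  obtain ⟨D, h0, hD⟩ := hK.adjoint.norm_row_le (stdOrthonormalBasis ℂ F α)
  refine summable_integral_sq_norm_inner (hK.adjoint.aestronglyMeasurable_inner_row _)
      (w := fun x => D * decayWeight (n + 1) x) ?_ hD b.orthonormal
  simp_rw [mul_pow]
  exact (integrable_decayWeight_sq (finrank_Rn_lt n) volume).const_mul _

end IsDecayingKernel

end Kernel
section KernelTrace

variable {n : ℕ} {F : Type*} [NormedAddCommGroup F] [InnerProductSpace ℂ F]

/-- The trace of endomorphisms of the fibre as a continuous linear functional. -/
noncomputable def traceCLM (F : Type*) [NormedAddCommGroup F] [InnerProductSpace ℂ F]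
    [FiniteDimensional ℂ F] : (F →L[ℂ] F) →L[ℂ] ℂ :=
  LinearMap.toContinuousLinearMap ((LinearMap.trace ℂ F) ∘ₗ ContinuousLinearMap.coeLM ℂ)

theorem traceCLM_apply [FiniteDimensional ℂ F] (A : F →L[ℂ] F) :
    traceCLM F A = LinearMap.trace ℂ F A.toLinearMap := rfl

theorem traceCLM_mul_comm [FiniteDimensional ℂ F] (A B : F →L[ℂ] F) :
    traceCLM F (A * B) = traceCLM F (B * A) := LinearMap.trace_mul_comm ℂ A.toLinearMap B.toLinearMap

theorem traceCLM_eq_sum [FiniteDimensional ℂ F] {κ : Type*} [Fintype κ]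
    (f : OrthonormalBasis κ ℂ F) (A : F →L[ℂ] F) :
    traceCLM F A = ∑ α, inner ℂ (f α) (A (f α)) := LinearMap.trace_eq_sum_inner _ f

namespace IsDecayingKernel

variable {K K' : Rn n → Rn n → F →L[ℂ] F}

theorem inner_toCLM_comp [CompleteSpace F] {κ : Type*} [Fintype κ] (hK : IsDecayingKernel K)
    (hK' : IsDecayingKernel K') (f : OrthonormalBasis κ ℂ F)
    (e : Lp F 2 (volume : Measure (Rn n))) :
    inner ℂ e ((hK.toCLM ∘L hK'.toCLM) e) =
      ∑ α, ∫ w, inner ℂ (hK'.adjoint.row (f α) w) e * inner ℂ e (hK.swap.row (f α) w) := by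
  set e' := hK'.toCLM e with he'
  obtain ⟨C, h0, hC⟩ := hK.exists_bound
  have hFub : Integrable (fun p : Rn n × Rn n => inner ℂ (e p.1) (K p.1 p.2 (e' p.2)))
      (volume.prod volume) := by
    refine (((integrable_weight_mul_norm e).mul_prod (integrable_weight_mul_norm e')).const_mul
      C).mono' ?_ (ae_of_all _ fun p => ?_)
    · refine (Lp.aestronglyMeasurable e).comp_fst.inner ?_
      exact isBoundedBilinearMap_apply.continuous.comp_aestronglyMeasurable
        (hK.cont.aestronglyMeasurable.prodMk (Lp.aestronglyMeasurable e').comp_snd)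
    · refine (norm_inner_le_norm _ _).trans ?_
      calc _ ≤ ‖e p.1‖ * ((C * (decayWeight (n + 1) p.1 * decayWeight (n + 1) p.2)) * ‖e' p.2‖) := by
            gcongr
            exact ((K p.1 p.2).le_opNorm _).trans
              (mul_le_mul_of_nonneg_right (hC _ _) (norm_nonneg _))
        _ = _ := by ring
  have hrow : ∀ (α : κ) (v : F) (w : Rn n),
      inner ℂ e (hK.swap.row v w) = ∫ x, inner ℂ (e x) (K x w v) := fun α v w => by
    rw [← inner_conj_symm, inner_row, ← integral_conj]
    simp
  have hi : ∀ (α : κ) (w : Rn n), Integrable fun x => inner ℂ (e x) (K x w (f α)) := fun α w =>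
    (L2.integrable_inner (𝕜 := ℂ) e (hK.swap.row (f α) w)).congr (by
      filter_upwards [(hK.swap.memLp_apply (f α) w).coeFn_toLp] with x hx
      rw [row, hx])
  rw [ContinuousLinearMap.comp_apply, ← he', L2.inner_def, ← integral_finsetSum]
  · calc ∫ x, inner ℂ (e x) (hK.toCLM e' x)
        = ∫ x, ∫ w, inner ℂ (e x) (K x w (e' w)) := by
          refine integral_congr_ae ?_
          filter_upwards [hK.toCLM_ae e'] with x hx
          rw [hx, integral_inner (hK.integrable_apply x e')]
      _ = ∫ w, ∫ x, inner ℂ (e x) (K x w (e' w)) := integral_integral_swap hFub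
      _ = _ := by
          refine integral_congr_ae ?_
          filter_upwards [hK'.toCLM_ae e] with w hw
          conv_lhs => rw [← f.sum_repr' (e' w)]
          simp only [map_sum, map_smul, inner_sum, inner_smul_right]
          rw [integral_finsetSum _ fun α _ => (hi α w).const_mul _]
          refine Finset.sum_congr rfl fun α _ => ?_
          rw [integral_const_mul, hrow α, he', hw, hK'.inner_integral_apply]
  · intro α _
    obtain ⟨D, h0, hD⟩ := hK'.adjoint.norm_row_le (f α)
    obtain ⟨D', h0', hD'⟩ := hK.swap.norm_row_le (f α)
    have hm := hK.swap.aestronglyMeasurable_inner_row (f α) e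
    have hm' : AEStronglyMeasurable (fun w => inner ℂ e (hK.swap.row (f α) w)) volume := by
      simpa using (RCLike.continuous_conj (K := ℂ)).comp_aestronglyMeasurable hm
    refine ((integrable_decayWeight_sq (finrank_Rn_lt n) volume).const_mul
      (D * ‖e‖ * (D' * ‖e‖))).mono'
        ((hK'.adjoint.aestronglyMeasurable_inner_row (f α) e).mul hm') (ae_of_all _ fun w => ?_)
    have h1 := decayWeight_nonneg (n + 1) w
    rw [norm_mul]
    calc _ ≤ ((D * decayWeight (n + 1) w) * ‖e‖) * (‖e‖ * (D' * decayWeight (n + 1) w)) := by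
          gcongr
          · exact (norm_inner_le_norm _ _).trans (by gcongr; exact hD w)
          · exact (norm_inner_le_norm _ _).trans (by gcongr; exact hD' w)
      _ = _ := by ring

theorem integrable_uncurry (hK : IsDecayingKernel K) :
    Integrable (fun p : Rn n × Rn n => K p.1 p.2) (volume.prod volume) := by
  obtain ⟨C, h0, hC⟩ := hK.exists_bound
  have hw := integrable_decayWeight (finrank_Rn_lt n) (volume : Measure (Rn n))
  exact ((hw.mul_prod hw).const_mul C).mono' hK.cont.aestronglyMeasurable
    (ae_of_all _ fun p => hC _ _)

theorem mul_swap (hK : IsDecayingKernel K) (hK' : IsDecayingKernel K') :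
    IsDecayingKernel fun w z => K' w z * K z w := by
  obtain ⟨C, h0, hC⟩ := hK.exists_bound
  obtain ⟨C', h0', hC'⟩ := hK'.exists_bound
  refine ⟨hK'.cont.mul (hK.cont.comp continuous_swap), C' * C, fun w z => ?_⟩
  refine (norm_mul_le _ _).trans ?_
  have h1 := decayWeight_nonneg (n + 1) w
  have h2 := decayWeight_nonneg (n + 1) z
  calc _ ≤ (C' * (decayWeight (n + 1) w * decayWeight (n + 1) z)) * (C * (1 * 1)) := by
        gcongr
        · exact hC' w z
        · refine (hC z w).trans ?_
          gcongr <;> exact decayWeight_le_one _ _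
    _ = _ := by ring

theorem integrable_right (hK : IsDecayingKernel K) (x : Rn n) : Integrable fun z => K x z := by
  obtain ⟨C, h0, hC⟩ := hK.exists_bound
  have hw := integrable_decayWeight (finrank_Rn_lt n) (volume : Measure (Rn n))
  have := hK.cont
  refine (hw.const_mul (C * decayWeight (n + 1) x)).mono'
    (Continuous.aestronglyMeasurable (by fun_prop)) (ae_of_all _ fun z => (hC x z).trans_eq (by ring))

/-- `A` acts on Schwartz functions through the integral kernel `K`. -/
def _root_.EquivariantIndex.HasKernel (A : Module.End ℂ 𝓢(Rn n, F)) (K : Rn n → Rn n → F →L[ℂ] F) : Prop :=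
  ∀ φ x, A φ x = ∫ z, K x z (φ z)

theorem toCLM_toLp (hK : IsDecayingKernel K) {A : Module.End ℂ 𝓢(Rn n, F)} (hA : HasKernel A K)
    (φ : 𝓢(Rn n, F)) : hK.toCLM (φ.toLp 2 volume) = (A φ).toLp 2 volume := by
  refine Lp.ext ?_
  filter_upwards [hK.toCLM_ae (φ.toLp 2 volume), (A φ).coeFn_toLp 2 volume] with x hx hx'
  rw [hx, hx', hA]
  refine integral_congr_ae ?_
  filter_upwards [φ.coeFn_toLp 2 volume] with z hz
  rw [hz]

theorem l2Extension_mul [CompleteSpace F] (hK : IsDecayingKernel K) (hK' : IsDecayingKernel K')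
    {A B : Module.End ℂ 𝓢(Rn n, F)} (hA : HasKernel A K) (hB : HasKernel B K') :
    IsL2Bounded (A * B) ∧ l2Extension (A * B) = hK.toCLM ∘L hK'.toCLM := by
  have h : ∀ φ : 𝓢(Rn n, F), (hK.toCLM ∘L hK'.toCLM) (φ.toLp 2 volume) =
      ((A * B) φ).toLp 2 volume := fun φ => by
    rw [ContinuousLinearMap.comp_apply, toCLM_toLp hK' hB, toCLM_toLp hK hA]
    rfl
  have hb : ∀ φ : 𝓢(Rn n, F), ‖((A * B) φ).toLp 2 volume‖ ≤
      ‖hK.toCLM ∘L hK'.toCLM‖ * ‖φ.toLp 2 volume‖ := fun φ => by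
    rw [← h]
    exact ContinuousLinearMap.le_opNorm _ _
  refine ⟨⟨_, hb⟩, ?_⟩
  exact LinearMap.extendOfNorm_unique
    (e := (SchwartzMap.toLpCLM ℂ F 2 (volume : Measure (Rn n))).toLinearMap)
    (SchwartzMap.denseRange_toLpCLM (F := F) (p := 2) (μ := (volume : Measure (Rn n)))
      ENNReal.ofNat_ne_top) _ hb _ (LinearMap.ext h)

variable [CompleteSpace F] [FiniteDimensional ℂ F]

theorem hilbertTrace_toCLM_comp (hK : IsDecayingKernel K) (hK' : IsDecayingKernel K') :
    IsTraceClass (hK.toCLM ∘L hK'.toCLM) ∧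
    hilbertTrace (hK.toCLM ∘L hK'.toCLM) = ∫ w, ∫ z, traceCLM F (K' w z * K z w) := by
  have : SecondCountableTopology F :=
    have := FiniteDimensional.proper ℂ F
    inferInstance
  let b := (exists_hilbertBasis ℂ (Lp F 2 (volume : Measure (Rn n)))).choose_spec.choose
  have : Fact ((2 : ENNReal) ≠ ⊤) := ⟨ENNReal.ofNat_ne_top⟩
  have : Countable (exists_hilbertBasis ℂ (Lp F 2 (volume : Measure (Rn n)))).choose :=
    countable_of_orthonormal b.orthonormal
  refine ⟨IsTraceClass.mul_of_summable_sq b (hK.summable_sq_norm_toCLM b)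
    (hK'.summable_sq_norm_toCLM b), ?_⟩
  let f := stdOrthonormalBasis ℂ F
  choose D h0 hD using fun α => hK'.adjoint.norm_row_le (f α)
  choose D' h0' hD' using fun α => hK.swap.norm_row_le (f α)
  have h := hasSum_inner_of_weak_rank_one b (T := hK.toCLM ∘L hK'.toCLM)
    (p := fun α w => hK.swap.row (f α) w) (q := fun α w => hK'.adjoint.row (f α) w)
    (μ := volume) (w := fun x => (∑ α, (D α + D' α)) * decayWeight (n + 1) x)
    (fun α e => hK.swap.aestronglyMeasurable_inner_row (f α) e)
    (fun α e => hK'.adjoint.aestronglyMeasurable_inner_row (f α) e)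
    (by
      simp_rw [mul_pow]
      exact (integrable_decayWeight_sq (finrank_Rn_lt n) volume).const_mul _)
    (fun α x => (hD' α x).trans (mul_le_mul_of_nonneg_right ((le_add_of_nonneg_left (h0 α)).trans
      (Finset.single_le_sum (f := fun α => D α + D' α) (fun α _ => add_nonneg (h0 α) (h0' α))
        (Finset.mem_univ α))) (decayWeight_nonneg _ _)))
    (fun α x => (hD α x).trans (mul_le_mul_of_nonneg_right ((le_add_of_nonneg_right (h0' α)).trans
      (Finset.single_le_sum (f := fun α => D α + D' α) (fun α _ => add_nonneg (h0 α) (h0' α))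
        (Finset.mem_univ α))) (decayWeight_nonneg _ _)))
    (hK.inner_toCLM_comp hK' f)
  refine h.tsum_eq.trans ?_
  have hrow : ∀ α w, inner ℂ (hK'.adjoint.row (f α) w) (hK.swap.row (f α) w) =
      ∫ z, inner ℂ (f α) ((K' w z * K z w) (f α)) := fun α w => by
    rw [inner_row]
    refine integral_congr_ae ?_
    filter_upwards [(hK.swap.memLp_apply (f α) w).coeFn_toLp] with z hz
    rw [row, hz, ContinuousLinearMap.adjoint_inner_left]
    rfl
  simp_rw [hrow]
  let ev : Fin (Module.finrank ℂ F) → (F →L[ℂ] F) →L[ℂ] ℂ := fun α =>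
    innerSL ℂ (f α) ∘L ContinuousLinearMap.apply ℂ F (f α)
  have hev : ∀ α A, inner ℂ (f α) (A (f α)) = ev α A := fun α A => rfl
  have hM := hK.mul_swap hK'
  simp_rw [traceCLM_eq_sum f, hev]
  rw [← integral_finsetSum]
  · refine integral_congr_ae (ae_of_all _ fun w => ?_)
    exact (integral_finsetSum _ fun α _ => (ev α).integrable_comp (hM.integrable_right w)).symm
  · intro α _
    exact ((ev α).integrable_comp hM.integrable_uncurry).integral_prod_left

/-- The trace of a product of two integral operators. -/
theorem l2Trace_mul (hK : IsDecayingKernel K) (hK' : IsDecayingKernel K')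
    {A B : Module.End ℂ 𝓢(Rn n, F)} (hA : HasKernel A K) (hB : HasKernel B K') :
    IsTraceClassOnL2 (A * B) ∧
    l2Trace (A * B) = ∫ w, ∫ z, traceCLM F (K' w z * K z w) := by
  obtain ⟨h1, h2⟩ := l2Extension_mul hK hK' hA hB
  obtain ⟨h3, h4⟩ := hilbertTrace_toCLM_comp hK hK'
  exact ⟨⟨h1, h2 ▸ h3⟩, by rw [l2Trace, h2, h4]⟩

end IsDecayingKernel

end KernelTrace
section RapidFamily

variable {n : ℕ} {F : Type*} [NormedAddCommGroup F] [InnerProductSpace ℂ F]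

/-- Continuous families of functions `k(x, y, h)` with values in the endomorphisms of the fibre
which are rapidly decreasing in `(x, y)`, uniformly in `h`. -/
structure IsRapidFamily (k : Rn n → Rn n → ℝ → F →L[ℂ] F) : Prop where
  cont : Continuous fun p : Rn n × Rn n × ℝ => k p.1 p.2.1 p.2.2
  bound : ∀ N : ℕ, ∃ C, 0 ≤ C ∧
    ∀ x y h, ‖k x y h‖ ≤ C * (decayWeight N x * decayWeight N y)

/-- Composition of families in the convolution algebra of the tangent groupoid. -/
noncomputable def groupoidConv (a b : Rn n → Rn n → ℝ → F →L[ℂ] F) (x y : Rn n) (h : ℝ) :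
    F →L[ℂ] F :=
  ∫ y', a x y' h * b (x + h • y') (y - y') h

/-- The Schwartz kernel at parameter `h` of the operator
`φ ↦ ∫ k(x, y, h) φ(x + h y) dy`. -/
noncomputable def scaledKernel (k : Rn n → Rn n → ℝ → F →L[ℂ] F) (h : ℝ) (x z : Rn n) :
    F →L[ℂ] F :=
  (h ^ n)⁻¹ • k x (h⁻¹ • (z - x)) h

theorem integral_comp_add_smul {E : Type*} [NormedAddCommGroup E] [NormedSpace ℝ E]
    {h : ℝ} (hh : 0 < h) (x : Rn n) (G : Rn n → E) :
    ∫ y, G (x + h • y) = (h ^ n)⁻¹ • ∫ z, G z := by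
  rw [Measure.integral_comp_smul_of_nonneg volume (fun z => G (x + z)) h (hR := hh.le),
    integral_add_left_eq_self (μ := volume) G x, finrank_euclideanSpace_fin]

namespace IsRapidFamily

variable {a b k : Rn n → Rn n → ℝ → F →L[ℂ] F}

theorem norm_mul_le (ha : IsRapidFamily a) (hb : IsRapidFamily b) (N : ℕ) :
    ∃ C, 0 ≤ C ∧ ∀ x y' y h, ‖a x y' h * b (x + h • y') (y - y') h‖ ≤
      C * (decayWeight N x * decayWeight (n + 1) y' * decayWeight N y) := by
  obtain ⟨C, h0, hC⟩ := ha.bound (N + (n + 1))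
  obtain ⟨C', h0', hC'⟩ := hb.bound N
  refine ⟨C * C', by positivity, fun x y' y h => (_root_.norm_mul_le _ _).trans ?_⟩
  have p1 := decayWeight_nonneg (N + (n + 1)) x
  have p2 := decayWeight_nonneg (N + (n + 1)) y'
  have p3 := decayWeight_nonneg N (x + h • y')
  have p4 := decayWeight_nonneg N (y - y')
  have p5 := decayWeight_nonneg N x
  have p6 := decayWeight_nonneg (n + 1) y'
  have p7 := decayWeight_nonneg N y'
  calc ‖a x y' h‖ * ‖b (x + h • y') (y - y') h‖
      ≤ (C * (decayWeight (N + (n + 1)) x * decayWeight (N + (n + 1)) y')) *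
        (C' * (decayWeight N (x + h • y') * decayWeight N (y - y'))) := by
        gcongr
        · exact hC _ _ _
        · exact hC' _ _ _
    _ ≤ (C * (decayWeight N x * (decayWeight N y' * decayWeight (n + 1) y'))) *
        (C' * (1 * decayWeight N (y - y'))) := by
        gcongr
        · exact decayWeight_anti (by omega) x
        · rw [decayWeight_add_exponent]
        · exact decayWeight_le_one _ _
    _ = C * C' * (decayWeight N x * decayWeight (n + 1) y' *
        (decayWeight N y' * decayWeight N (y - y'))) := by ring
    _ ≤ C * C' * (decayWeight N x * decayWeight (n + 1) y' * decayWeight N (y' + (y - y'))) := by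
        gcongr
        exact decayWeight_mul_le _ _ _
    _ = _ := by rw [add_sub_cancel]

theorem continuous_mul (ha : IsRapidFamily a) (hb : IsRapidFamily b) :
    Continuous fun p : Rn n × Rn n × Rn n × ℝ =>
      a p.1 p.2.1 p.2.2.2 * b (p.1 + p.2.2.2 • p.2.1) (p.2.2.1 - p.2.1) p.2.2.2 :=
  (ha.cont.comp (g := fun p : Rn n × Rn n × ℝ => a p.1 p.2.1 p.2.2)
    (f := fun p : Rn n × Rn n × Rn n × ℝ => (p.1, p.2.1, p.2.2.2)) (by fun_prop)).mul
  (hb.cont.comp (g := fun p : Rn n × Rn n × ℝ => b p.1 p.2.1 p.2.2)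
    (f := fun p : Rn n × Rn n × Rn n × ℝ =>
      (p.1 + p.2.2.2 • p.2.1, p.2.2.1 - p.2.1, p.2.2.2)) (by fun_prop))

theorem integrable_mul (ha : IsRapidFamily a) (hb : IsRapidFamily b) (x y : Rn n) (h : ℝ) :
    Integrable fun y' => a x y' h * b (x + h • y') (y - y') h := by
  obtain ⟨C, h0, hC⟩ := ha.norm_mul_le hb 0
  have hc := ha.continuous_mul hb
  have hc' : Continuous fun y' => a x y' h * b (x + h • y') (y - y') h :=
    hc.comp (f := fun y' : Rn n => (x, y', y, h)) (by fun_prop)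
  refine ((integrable_decayWeight (finrank_Rn_lt n) volume).const_mul C).mono'
    hc'.aestronglyMeasurable (ae_of_all _ fun y' => (hC x y' y h).trans_eq ?_)
  simp [decayWeight]

theorem groupoidConv (ha : IsRapidFamily a) (hb : IsRapidFamily b) :
    IsRapidFamily (groupoidConv a b) := by
  have hc := ha.continuous_mul hb
  constructor
  · obtain ⟨C, h0, hC⟩ := ha.norm_mul_le hb 0
    refine continuous_of_dominated (bound := fun y' => C * decayWeight (n + 1) y')
      (F := fun (p : Rn n × Rn n × ℝ) y' => a p.1 y' p.2.2 * b (p.1 + p.2.2 • y') (p.2.1 - y') p.2.2)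
      (fun p => (ha.integrable_mul hb p.1 p.2.1 p.2.2).aestronglyMeasurable)
      (fun p => ae_of_all _ fun y' => (hC p.1 y' p.2.1 p.2.2).trans_eq (by simp [decayWeight]))
      ((integrable_decayWeight (finrank_Rn_lt n) volume).const_mul C)
      (ae_of_all _ fun y' => ?_)
    exact hc.comp (f := fun p : Rn n × Rn n × ℝ => (p.1, y', p.2.1, p.2.2)) (by fun_prop)
  · intro N
    obtain ⟨C, h0, hC⟩ := ha.norm_mul_le hb N
    refine ⟨C * ∫ y' : Rn n, decayWeight (n + 1) y', ?_, fun x y h => ?_⟩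
    · have : 0 ≤ ∫ y' : Rn n, decayWeight (n + 1) y' :=
        integral_nonneg fun y' => decayWeight_nonneg _ _
      positivity
    · have := norm_integral_le_of_norm_le (μ := volume)
        (f := fun y' => a x y' h * b (x + h • y') (y - y') h)
        (g := fun y' => (C * (decayWeight N x * decayWeight N y)) * decayWeight (n + 1) y')
        ((integrable_decayWeight (finrank_Rn_lt n) volume).const_mul _)
        (ae_of_all _ fun y' => (hC x y' y h).trans_eq (by ring))
      rw [integral_const_mul] at this
      exact this.trans_eq (by ring)

theorem integrable_mul_prod (ha : IsRapidFamily a) (hb : IsRapidFamily b) (x : Rn n) (h : ℝ) :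
    Integrable (fun p : Rn n × Rn n => a x p.1 h * b (x + h • p.1) (p.2 - p.1) h)
      (volume.prod volume) := by
  obtain ⟨C, h0, hC⟩ := ha.norm_mul_le hb (n + 1)
  have hw := integrable_decayWeight (finrank_Rn_lt n) (volume : Measure (Rn n))
  have hc' : Continuous fun p : Rn n × Rn n => a x p.1 h * b (x + h • p.1) (p.2 - p.1) h :=
    (ha.continuous_mul hb).comp (f := fun p : Rn n × Rn n => (x, p.1, p.2, h)) (by fun_prop)
  refine ((hw.mul_prod hw).const_mul (C * decayWeight (n + 1) x)).mono' hc'.aestronglyMeasurable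
    (ae_of_all _ fun p => (hC x p.1 p.2 h).trans_eq (by ring))

theorem integrable_right (hk : IsRapidFamily k) (x : Rn n) (h : ℝ) :
    Integrable fun y => k x y h := by
  obtain ⟨C, h0, hC⟩ := hk.bound (n + 1)
  have hc : Continuous fun y => k x y h :=
    hk.cont.comp (f := fun y : Rn n => (x, y, h)) (by fun_prop)
  exact ((integrable_decayWeight (finrank_Rn_lt n) volume).const_mul
    (C * decayWeight (n + 1) x)).mono' hc.aestronglyMeasurable
    (ae_of_all _ fun y => (hC x y h).trans_eq (by ring))

/-- The symbol of a composition at `h = 0` is the product of the symbols. -/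
theorem symbol_groupoidConv [CompleteSpace F] (ha : IsRapidFamily a) (hb : IsRapidFamily b)
    (x ξ : Rn n) :
    ∫ y, Complex.exp (Complex.I * (inner ℝ y ξ : ℝ)) • EquivariantIndex.groupoidConv a b x y 0 =
      (∫ y, Complex.exp (Complex.I * (inner ℝ y ξ : ℝ)) • a x y 0) *
        ∫ y, Complex.exp (Complex.I * (inner ℝ y ξ : ℝ)) • b x y 0 := by
  have hexp : ∀ t : ℝ, ‖Complex.exp (Complex.I * (t : ℂ))‖ = 1 := fun t => by
    simp [Complex.norm_exp]
  have hint : ∀ {k : Rn n → Rn n → ℝ → F →L[ℂ] F}, IsRapidFamily k →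
      Integrable fun y => Complex.exp (Complex.I * (inner ℝ y ξ : ℝ)) • k x y 0 := fun {k} hk => by
    refine (hk.integrable_right x 0).norm.mono' ?_ (ae_of_all _ fun y => ?_)
    · have : Continuous fun y : Rn n => Complex.exp (Complex.I * (inner ℝ y ξ : ℝ)) := by fun_prop
      exact this.aestronglyMeasurable.smul (hk.integrable_right x 0).aestronglyMeasurable
    · rw [norm_smul, hexp, one_mul]
  simp only [EquivariantIndex.groupoidConv, zero_smul, add_zero]
  have hprod := ha.integrable_mul_prod hb x 0
  simp only [zero_smul, add_zero] at hprod
  calc ∫ y, Complex.exp (Complex.I * (inner ℝ y ξ : ℝ)) • ∫ y', a x y' 0 * b x (y - y') 0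
      = ∫ y, ∫ y', Complex.exp (Complex.I * (inner ℝ y ξ : ℝ)) • (a x y' 0 * b x (y - y') 0) := by
        simp_rw [integral_smul]
    _ = ∫ y', ∫ y, Complex.exp (Complex.I * (inner ℝ y ξ : ℝ)) • (a x y' 0 * b x (y - y') 0) := by
        refine (integral_integral_swap ?_).symm
        refine hprod.norm.mono' ?_ (ae_of_all _ fun p => ?_)
        · have : Continuous fun p : Rn n × Rn n =>
            Complex.exp (Complex.I * (inner ℝ p.2 ξ : ℝ)) := by fun_prop
          exact this.aestronglyMeasurable.smul hprod.aestronglyMeasurable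
        · simp only [Function.uncurry_def]
          rw [norm_smul, hexp, one_mul]
    _ = ∫ y', (Complex.exp (Complex.I * (inner ℝ y' ξ : ℝ)) • a x y' 0) *
          ∫ y, Complex.exp (Complex.I * (inner ℝ y ξ : ℝ)) • b x y 0 := by
        refine integral_congr_ae (ae_of_all _ fun y' => ?_)
        simp only
        rw [← integral_sub_right_eq_self (μ := volume)
          (fun y => Complex.exp (Complex.I * (inner ℝ y ξ : ℝ)) • b x y 0) y',
          ← integral_const_mul_of_integrable ((hint hb).comp_sub_right y')]
        refine integral_congr_ae (ae_of_all _ fun y => ?_)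
        simp only [smul_mul_smul_comm, ← Complex.exp_add, inner_sub_left]
        congr 2
        push_cast
        ring
    _ = _ := integral_mul_const_of_integrable (hint ha)

/-- Composition of the operators attached to rapid families. -/
theorem op_comp [CompleteSpace F] (ha : IsRapidFamily a) (hb : IsRapidFamily b) (h : ℝ)
    (φ : 𝓢(Rn n, F)) (x : Rn n) :
    ∫ y, a x y h (∫ y', b (x + h • y) y' h (φ (x + h • y + h • y'))) =
      ∫ y, EquivariantIndex.groupoidConv a b x y h (φ (x + h • y)) := by
  obtain ⟨M, hM⟩ : ∃ M, ∀ x, ‖φ x‖ ≤ M := by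
    obtain ⟨C, hC⟩ := φ.decay 0 0
    exact ⟨C, fun x => by simpa using hC.2 x⟩
  have hφ : Continuous fun z => φ (x + h • z) := by have := φ.continuous; fun_prop
  have hprod := ha.integrable_mul_prod hb x h
  have hP : Integrable (fun p : Rn n × Rn n =>
      (a x p.1 h * b (x + h • p.1) (p.2 - p.1) h) (φ (x + h • p.2))) (volume.prod volume) := by
    refine (hprod.norm.mul_const M).mono' ?_ (ae_of_all _ fun p => ?_)
    · exact isBoundedBilinearMap_apply.continuous.comp_aestronglyMeasurable
        (hprod.aestronglyMeasurable.prodMk (hφ.comp continuous_snd).aestronglyMeasurable)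
    · exact (ContinuousLinearMap.le_opNorm _ _).trans (by gcongr; exact hM _)
  calc ∫ y, a x y h (∫ y', b (x + h • y) y' h (φ (x + h • y + h • y')))
      = ∫ y, ∫ z, (a x y h * b (x + h • y) (z - y) h) (φ (x + h • z)) := by
        refine integral_congr_ae (ae_of_all _ fun y => ?_)
        simp only
        rw [← ContinuousLinearMap.integral_comp_comm, ← integral_sub_right_eq_self _ y]
        · refine integral_congr_ae (ae_of_all _ fun z => ?_)
          simp only [add_assoc, ← smul_add, add_sub_cancel]
          rfl
        · have hi := hb.integrable_right (x + h • y) h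
          refine (hi.norm.mul_const M).mono' ?_ (ae_of_all _ fun y' =>
            (ContinuousLinearMap.le_opNorm _ _).trans (by gcongr; exact hM _))
          have hφ' : Continuous fun y' => φ (x + h • y + h • y') := by
            have := φ.continuous; fun_prop
          exact isBoundedBilinearMap_apply.continuous.comp_aestronglyMeasurable
            (hi.aestronglyMeasurable.prodMk hφ'.aestronglyMeasurable)
    _ = ∫ z, ∫ y, (a x y h * b (x + h • y) (z - y) h) (φ (x + h • z)) := integral_integral_swap hP
    _ = _ := by
        refine integral_congr_ae (ae_of_all _ fun z => ?_)
        exact (ContinuousLinearMap.integral_apply (ha.integrable_mul hb x z h) _).symm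

theorem isDecayingKernel (hk : IsRapidFamily k) {h : ℝ} (hh : 0 < h) :
    IsDecayingKernel (scaledKernel k h) := by
  obtain ⟨C, h0, hC⟩ := hk.bound ((n + 1) + (n + 1))
  constructor
  · have hc : Continuous fun p : Rn n × Rn n => k p.1 (h⁻¹ • (p.2 - p.1)) h :=
      hk.cont.comp (f := fun p : Rn n × Rn n => (p.1, h⁻¹ • (p.2 - p.1), h)) (by fun_prop)
    exact hc.const_smul (h ^ n)⁻¹
  · refine ⟨(h ^ n)⁻¹ * C * (1 + h) ^ (n + 1), fun x z => ?_⟩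
    have hw : decayWeight (n + 1) (h⁻¹ • (z - x)) ≤
        (1 + h) ^ (n + 1) * decayWeight (n + 1) (z - x) := by
      unfold decayWeight
      rw [← div_eq_mul_inv, le_div_iff₀ (by positivity), inv_mul_le_iff₀ (by positivity), ← mul_pow]
      gcongr
      rw [norm_smul, norm_inv, Real.norm_of_nonneg hh.le]
      have : h * (h⁻¹ * ‖z - x‖) = ‖z - x‖ := by field_simp
      have h3 : 0 ≤ h⁻¹ * ‖z - x‖ := by positivity
      nlinarith
    have p1 := decayWeight_nonneg (n + 1) x
    have p2 := decayWeight_nonneg (n + 1) (h⁻¹ • (z - x))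
    rw [scaledKernel, norm_smul, Real.norm_of_nonneg (by positivity)]
    calc (h ^ n)⁻¹ * ‖k x (h⁻¹ • (z - x)) h‖
        ≤ (h ^ n)⁻¹ * (C * ((decayWeight (n + 1) x * decayWeight (n + 1) x) *
            (1 * decayWeight (n + 1) (h⁻¹ • (z - x))))) := by
          gcongr
          refine (hC _ _ _).trans ?_
          rw [decayWeight_add_exponent (n + 1) (n + 1), decayWeight_add_exponent (n + 1) (n + 1)]
          gcongr
          exact decayWeight_le_one _ _
      _ ≤ (h ^ n)⁻¹ * (C * ((decayWeight (n + 1) x * decayWeight (n + 1) x) *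
            (1 * ((1 + h) ^ (n + 1) * decayWeight (n + 1) (z - x))))) := by gcongr
      _ = (h ^ n)⁻¹ * C * (1 + h) ^ (n + 1) * (decayWeight (n + 1) x *
            (decayWeight (n + 1) x * decayWeight (n + 1) (z - x))) := by ring
      _ ≤ (h ^ n)⁻¹ * C * (1 + h) ^ (n + 1) * (decayWeight (n + 1) x *
            decayWeight (n + 1) (x + (z - x))) := by
          gcongr
          exact decayWeight_mul_le _ _ _
      _ = _ := by rw [add_sub_cancel]

theorem integral_scaledKernel_apply {h : ℝ} (hh : 0 < h) (φ : Rn n → F) (x : Rn n) :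
    ∫ z, scaledKernel k h x z (φ z) = ∫ y, k x y h (φ (x + h • y)) := by
  have := integral_comp_add_smul hh x fun z => k x (h⁻¹ • (z - x)) h (φ z)
  simp only [add_sub_cancel_left, smul_smul, inv_mul_cancel₀ hh.ne', one_smul] at this
  rw [this, ← integral_smul]
  rfl

theorem integral_scaledKernel_mul {h : ℝ} (hh : 0 < h) (x z : Rn n) :
    ∫ w, scaledKernel a h x w * scaledKernel b h w z =
      scaledKernel (EquivariantIndex.groupoidConv a b) h x z := by
  have h1 := integral_comp_add_smul hh x fun w => a x (h⁻¹ • (w - x)) h * b w (h⁻¹ • (z - w)) h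
  have h2 : ∀ y : Rn n, h⁻¹ • (z - (x + h • y)) = h⁻¹ • (z - x) - y := fun y => by
    rw [← sub_sub, smul_sub _ (z - x), smul_smul, inv_mul_cancel₀ hh.ne', one_smul]
  simp only [add_sub_cancel_left, smul_smul, inv_mul_cancel₀ hh.ne', one_smul, h2] at h1
  simp only [scaledKernel, EquivariantIndex.groupoidConv]
  rw [h1]
  simp only [smul_mul_smul_comm]
  rw [integral_smul, smul_smul]

end IsRapidFamily

end RapidFamily
section Quantization

variable {n : ℕ} {F : Type*} [NormedAddCommGroup F] [InnerProductSpace ℂ F]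

/-- The family of operators `T` on Schwartz functions is given by the rapid family `k`. -/
def ActsBy (T : ℝ → Module.End ℂ 𝓢(Rn n, F)) (k : Rn n → Rn n → ℝ → F →L[ℂ] F) : Prop :=
  ∀ h, 0 < h → ∀ φ x, T h φ x = ∫ y, k x y h (φ (x + h • y))

/-- The symbol at `h = 0` of a rapid family. -/
noncomputable def symbolAtZero (k : Rn n → Rn n → ℝ → F →L[ℂ] F) (x ξ : Rn n) : F →L[ℂ] F :=
  ∫ y, Complex.exp (Complex.I * (inner ℝ y ξ : ℝ)) • k x y 0

/-- The family of operators `T` is a quantization of the integrable symbol `P`. -/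
def IsQuantization (T : ℝ → Module.End ℂ 𝓢(Rn n, F)) (P : Rn n → Rn n → F →L[ℂ] F) : Prop :=
  IsDecayingKernel P ∧ ∃ k, IsRapidFamily k ∧ ActsBy T k ∧ symbolAtZero k = P

theorem ActsBy.hasKernel {T : ℝ → Module.End ℂ 𝓢(Rn n, F)} {k : Rn n → Rn n → ℝ → F →L[ℂ] F}
    (hT : ActsBy T k) {h : ℝ} (hh : 0 < h) : HasKernel (T h) (scaledKernel k h) := fun φ x => by
  rw [hT h hh, IsRapidFamily.integral_scaledKernel_apply hh]

theorem IsQuantization.mul [CompleteSpace F] {T T' : ℝ → Module.End ℂ 𝓢(Rn n, F)}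
    {P P' : Rn n → Rn n → F →L[ℂ] F} (hT : IsQuantization T P) (hT' : IsQuantization T' P') :
    IsQuantization (T * T') (fun x ξ => P x ξ * P' x ξ) := by
  obtain ⟨hP, k, hk, hTk, hs⟩ := hT
  obtain ⟨hP', k', hk', hTk', hs'⟩ := hT'
  refine ⟨hP'.swap.mul_swap hP, groupoidConv k k', hk.groupoidConv hk', fun h hh φ x => ?_, ?_⟩
  · rw [← hk.op_comp hk']
    change T h (T' h φ) x = _
    rw [hTk h hh]
    simp_rw [hTk' h hh]
  · funext x ξ
    rw [← hs, ← hs']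
    exact hk.symbol_groupoidConv hk' x ξ

theorem IsQuantization.list_prod [CompleteSpace F] {T : ℝ → Module.End ℂ 𝓢(Rn n, F)}
    {P : Rn n → Rn n → F →L[ℂ] F} (hT : IsQuantization T P) (m : ℕ) :
    ∀ {S : Fin m → ℝ → Module.End ℂ 𝓢(Rn n, F)} {Q : Fin m → Rn n → Rn n → F →L[ℂ] F},
    (∀ i, IsQuantization (S i) (Q i)) →
    IsQuantization (fun h => T h * (List.ofFn fun i => S i h).prod)
      (fun x ξ => P x ξ * (List.ofFn fun i => Q i x ξ).prod) := by
  induction m generalizing T P with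
  | zero => intro S Q _; simpa using hT
  | succ m ih =>
    intro S Q h
    have := ih (hT.mul (h 0)) fun i => h i.succ
    simpa only [List.ofFn_succ, List.prod_cons, ← mul_assoc] using! this

variable {G : Subgroup (Matrix.specialOrthogonalGroup (Fin n) ℝ)}

theorem norm_act (g : G) (x : Rn n) : ‖act g x‖ = ‖x‖ := by
  have h := inner_act_act g x x
  rw [real_inner_self_eq_norm_sq, real_inner_self_eq_norm_sq] at h
  exact (pow_left_inj₀ (norm_nonneg _) (norm_nonneg _) two_ne_zero).1 h

/-- The action as a linear isometry. -/
noncomputable def actIsometry (g : G) : Rn n ≃ₗᵢ[ℝ] Rn n where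
  toLinearEquiv := (actEquiv g).toLinearEquiv
  norm_map' := norm_act g

theorem actIsometry_apply (g : G) (x : Rn n) : actIsometry g x = act g x := rfl

theorem IsDecayingKernel.hatAction {K : Rn n → Rn n → F →L[ℂ] F} (hK : IsDecayingKernel K)
    (g : G) (γ : F →L[ℂ] F) : IsDecayingKernel fun x z => γ * K (act g⁻¹ x) z := by
  obtain ⟨C, h0, hC⟩ := hK.exists_bound
  refine ⟨continuous_const.mul (hK.cont.comp (f := fun p : Rn n × Rn n => (act g⁻¹ p.1, p.2))
    (by fun_prop)), ‖γ‖ * C, fun x z => (_root_.norm_mul_le _ _).trans ?_⟩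
  rw [mul_assoc]
  gcongr
  refine (hC _ _).trans_eq ?_
  simp [decayWeight, norm_act]

theorem HasKernel.hatAction [CompleteSpace F] {K : Rn n → Rn n → F →L[ℂ] F}
    (hK : IsDecayingKernel K) {A : Module.End ℂ 𝓢(Rn n, F)} (hA : HasKernel A K) (g : G)
    (γ : F →L[ℂ] F) :
    HasKernel (hatAction g γ * A) fun x z => γ * K (act g⁻¹ x) z := fun φ x => by
  change γ (A φ (act g⁻¹ x)) = ∫ z, γ (K (act g⁻¹ x) z (φ z))
  rw [hA, ContinuousLinearMap.integral_comp_comm]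
  refine (hK.integrable_apply (act g⁻¹ x) (φ.toLp 2 volume)).congr ?_
  filter_upwards [φ.coeFn_toLp 2 volume] with z hz
  rw [hz]

/-- The trace of `ĝ A B` for two quantized operators. -/
theorem l2Trace_hatAction_mul [CompleteSpace F] [FiniteDimensional ℂ F]
    {A B : ℝ → Module.End ℂ 𝓢(Rn n, F)} {a b : Rn n → Rn n → ℝ → F →L[ℂ] F}
    (ha : IsRapidFamily a) (hb : IsRapidFamily b) (hA : ActsBy A a) (hB : ActsBy B b)
    (g : G) (γ : F →L[ℂ] F) {h : ℝ} (hh : 0 < h) :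
    IsTraceClassOnL2 (hatAction g γ * A h * B h) ∧
    l2Trace (hatAction g γ * A h * B h) =
      ∫ y, traceCLM F (γ * scaledKernel (groupoidConv a b) h y (act g y)) := by
  have hKa := ha.isDecayingKernel hh
  have hKb := hb.isDecayingKernel hh
  have hK := hKa.hatAction g γ
  obtain ⟨h1, h2⟩ := hK.l2Trace_mul hKb (HasKernel.hatAction hKa (hA.hasKernel hh) g γ)
    (hB.hasKernel hh)
  refine ⟨h1, h2.trans ?_⟩
  have hM := hK.mul_swap hKb
  rw [integral_integral_swap ((traceCLM F).integrable_comp hM.integrable_uncurry),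
    ← (actIsometry g).measurePreserving.integral_comp
      (actIsometry g).toHomeomorph.measurableEmbedding]
  refine integral_congr_ae (ae_of_all _ fun y => ?_)
  simp only [actIsometry_apply, act_inv_act]
  rw [← IsRapidFamily.integral_scaledKernel_mul hh]
  have hi : Integrable fun w => scaledKernel a h y w * scaledKernel b h w (act g y) := by
    obtain ⟨C, h0, hC⟩ := hKa.exists_bound
    obtain ⟨C', h0', hC'⟩ := hKb.exists_bound
    have hc1 : Continuous fun w => scaledKernel a h y w :=
      hKa.cont.comp (f := fun w : Rn n => (y, w)) (by fun_prop)
    have hc2 : Continuous fun w => scaledKernel b h w (act g y) :=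
      hKb.cont.comp (f := fun w : Rn n => (w, act g y)) (by fun_prop)
    refine ((hKa.integrable_right y).norm.mul_const (C' * (1 * 1))).mono'
      (hc1.mul hc2).aestronglyMeasurable (ae_of_all _ fun w => (norm_mul_le _ _).trans ?_)
    gcongr
    refine (hC' _ _).trans ?_
    have := decayWeight_nonneg (n + 1) w
    have := decayWeight_nonneg (n + 1) (act g y)
    gcongr <;> exact decayWeight_le_one _ _
  rw [← integral_const_mul_of_integrable hi,
    ← ContinuousLinearMap.integral_comp_comm _ (hi.const_mul γ)]
  refine integral_congr_ae (ae_of_all _ fun w => ?_)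
  simp only
  rw [traceCLM_mul_comm, mul_assoc]

end Quantization
theorem norm_cexp_neg_I_mul (t : ℝ) : ‖Complex.exp (-(Complex.I * (t : ℂ)))‖ = 1 := by
  simp [Complex.norm_exp]

theorem norm_cexp_I_mul (t : ℝ) : ‖Complex.exp (Complex.I * (t : ℂ))‖ = 1 := by
  simp [Complex.norm_exp]

section FourierInversion

variable {n : ℕ} {E : Type*} [NormedAddCommGroup E] [NormedSpace ℂ E] [CompleteSpace E]

/-- Fourier inversion for the transform with kernel `e^{-i⟨y, ξ⟩}`. -/
theorem fourier_inversion_exp {H : Rn n → E} (hc : Continuous H) (hi : Integrable H)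
    (hi' : Integrable fun y => ∫ ξ, Complex.exp (-(Complex.I * (inner ℝ y ξ : ℝ))) • H ξ)
    (ξ : Rn n) :
    ∫ y, Complex.exp (Complex.I * (inner ℝ y ξ : ℝ)) •
      ∫ η, Complex.exp (-(Complex.I * (inner ℝ y η : ℝ))) • H η =
    (2 * Real.pi) ^ n • H ξ := by
  have hp : (0 : ℝ) < 2 * Real.pi := by positivity
  have h1 : ∀ w : Rn n, ∫ η, Complex.exp (-(Complex.I * (inner ℝ ((2 * Real.pi) • w) η : ℝ))) • H η =
      FourierTransform.fourier H w := fun w => by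
    rw [Real.fourier_eq']
    refine integral_congr_ae (ae_of_all _ fun η => ?_)
    simp only [inner_smul_left, real_inner_comm]
    congr 2
    push_cast
    simp
    ring
  have h2 : Integrable (FourierTransform.fourier H) := by
    have := hi'.comp_smul hp.ne'
    simpa only [h1] using this
  have h3 := congrFun (hc.fourierInv_fourier_eq hi h2) ξ
  rw [Real.fourierInv_eq'] at h3
  rw [← h3]
  have h4 := Measure.integral_comp_smul_of_nonneg (volume : Measure (Rn n))
    (fun y => Complex.exp (Complex.I * (inner ℝ y ξ : ℝ)) •
      ∫ η, Complex.exp (-(Complex.I * (inner ℝ y η : ℝ))) • H η) (2 * Real.pi) (hR := hp.le)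
  rw [finrank_euclideanSpace_fin, eq_inv_smul_iff₀ (by positivity)] at h4
  rw [← h4]
  congr 1
  refine integral_congr_ae (ae_of_all _ fun w => ?_)
  simp only [h1]
  congr 2
  simp only [inner_smul_left]
  push_cast
  simp
  ring

end FourierInversion

section PartialFourier

variable {n : ℕ} {E : Type*} [NormedAddCommGroup E] [NormedSpace ℂ E]

theorem schwartz_bound (f : 𝓢(Rn n × Rn n × ℝ, E)) (N M : ℕ) :
    ∃ C, 0 ≤ C ∧ ∀ x ξ h, ‖f (x, ξ, h)‖ ≤ C * (decayWeight N x * decayWeight M ξ) := by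
  refine ⟨2 ^ (N + M) * (Finset.Iic (N + M, 0)).sup
    (fun m => SchwartzMap.seminorm ℝ m.1 m.2) f, by positivity, fun x ξ h => ?_⟩
  have hs := SchwartzMap.one_add_le_sup_seminorm_apply (𝕜 := ℝ) (m := (N + M, 0))
    (le_refl (N + M)) (le_refl 0) f (x, ξ, h)
  rw [norm_iteratedFDeriv_zero] at hs
  unfold decayWeight
  rw [← mul_inv, ← div_eq_mul_inv, le_div_iff₀ (by positivity)]
  refine le_trans ?_ hs
  rw [mul_comm, pow_add]
  have h1 : ‖x‖ ≤ ‖(x, ξ, h)‖ := norm_fst_le (x, ξ, h)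
  have h2 : ‖ξ‖ ≤ ‖(x, ξ, h)‖ := (norm_fst_le (ξ, h)).trans (norm_snd_le (x, ξ, h))
  gcongr

theorem schwartz_integrable_section (f : 𝓢(Rn n × Rn n × ℝ, E)) (x : Rn n) (h : ℝ) :
    Integrable fun ξ => f (x, ξ, h) := schwartz_section_integrable (schwartzSlice h f) x

theorem integrable_cexp_smul {H : Rn n → E} (hi : Integrable H) (y : Rn n) :
    Integrable fun ξ => Complex.exp (-(Complex.I * (inner ℝ y ξ : ℝ))) • H ξ := by
  have hc : Continuous fun ξ : Rn n => Complex.exp (-(Complex.I * (inner ℝ y ξ : ℝ))) := by fun_prop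
  refine hi.norm.mono' (hc.aestronglyMeasurable.smul hi.aestronglyMeasurable)
    (ae_of_all _ fun ξ => ?_)
  rw [norm_smul, norm_cexp_neg_I_mul, one_mul]

theorem continuous_partialFourier (f : 𝓢(Rn n × Rn n × ℝ, E)) :
    Continuous fun p : Rn n × Rn n × ℝ => partialFourier f p.1 p.2.1 p.2.2 := by
  obtain ⟨C, h0, hC⟩ := schwartz_bound f 0 (n + 1)
  have hf := f.continuous
  refine continuous_of_dominated (bound := fun ξ => C * decayWeight (n + 1) ξ)
    (F := fun (p : Rn n × Rn n × ℝ) ξ =>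
      Complex.exp (-(Complex.I * (inner ℝ p.2.1 ξ : ℝ))) • f (p.1, ξ, p.2.2))
    (fun p => Continuous.aestronglyMeasurable (by fun_prop))
    (fun p => ae_of_all _ fun ξ => ?_)
    ((integrable_decayWeight (finrank_Rn_lt n) volume).const_mul C)
    (ae_of_all _ fun ξ => by fun_prop)
  rw [norm_smul, norm_cexp_neg_I_mul, one_mul]
  exact (hC _ _ _).trans_eq (by simp [decayWeight])

theorem norm_partialFourier_le (f : 𝓢(Rn n × Rn n × ℝ, E)) (N : ℕ) :
    ∃ C, 0 ≤ C ∧ ∀ x y h, ‖partialFourier f x y h‖ ≤ C * decayWeight N x := by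
  obtain ⟨C, h0, hC⟩ := schwartz_bound f N (n + 1)
  have hI : 0 ≤ ∫ ξ : Rn n, decayWeight (n + 1) ξ :=
    integral_nonneg fun y' => decayWeight_nonneg _ _
  refine ⟨C * ∫ ξ : Rn n, decayWeight (n + 1) ξ, by positivity, fun x y h => ?_⟩
  have := norm_integral_le_of_norm_le (μ := volume)
    (f := fun ξ => Complex.exp (-(Complex.I * (inner ℝ y ξ : ℝ))) • f (x, ξ, h))
    (g := fun ξ => (C * decayWeight N x) * decayWeight (n + 1) ξ)
    ((integrable_decayWeight (finrank_Rn_lt n) volume).const_mul _)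
    (ae_of_all _ fun ξ => by
      rw [norm_smul, norm_cexp_neg_I_mul, one_mul]
      exact (hC x ξ h).trans_eq (by ring))
  rw [integral_const_mul] at this
  exact this.trans_eq (by ring)

/-- The direction `v` in the base variable of `T*ℝⁿ × ℝ`. -/
def baseDir (v : Rn n) : Rn n × Rn n × ℝ := (v, 0, 0)

/-- The direction `v` in the fibre variable of `T*ℝⁿ × ℝ`. -/
def fibreDir (v : Rn n) : Rn n × Rn n × ℝ := (0, v, 0)

theorem partialFourier_lineDeriv_fibre (f : 𝓢(Rn n × Rn n × ℝ, E)) (v x y : Rn n) (h : ℝ) :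
    partialFourier (∂_{fibreDir v} f) x y h =
      (Complex.I * (inner ℝ y v : ℝ)) • partialFourier f x y h := by
  have hd : ∀ ξ, HasFDerivAt (fun ξ => f (x, ξ, h))
      ((fderiv ℝ f (x, ξ, h)) ∘L (ContinuousLinearMap.inr ℝ (Rn n) (Rn n × ℝ)) ∘L
        (ContinuousLinearMap.inl ℝ (Rn n) ℝ)) ξ := fun ξ =>
    (f.hasFDerivAt (x, ξ, h)).comp (f := fun ξ => (x, ξ, h)) ξ
      (((hasFDerivAt_prodMk_right x (ξ, h)).comp (f := fun ξ => (ξ, h)) ξ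
        (hasFDerivAt_prodMk_left ξ h)))
  have hfd : ∀ ξ, fderiv ℝ (fun ξ => f (x, ξ, h)) ξ v = (∂_{fibreDir v} f) (x, ξ, h) := fun ξ => by
    rw [(hd ξ).fderiv, SchwartzMap.lineDerivOp_apply_eq_fderiv]
    simp [fibreDir]
  have hed : ∀ ξ, HasFDerivAt (fun ξ : Rn n => Complex.exp (-(Complex.I * (inner ℝ y ξ : ℝ))))
      (Complex.exp (-(Complex.I * (inner ℝ y ξ : ℝ))) •
        -(Complex.I • (Complex.ofRealCLM ∘L innerSL ℝ y))) ξ := fun ξ => by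
    have h1 : HasFDerivAt (fun ξ : Rn n => ((inner ℝ y ξ : ℝ) : ℂ))
        (Complex.ofRealCLM ∘L innerSL ℝ y) ξ := (Complex.ofRealCLM ∘L innerSL ℝ y).hasFDerivAt
    exact (h1.const_mul Complex.I).fun_neg.cexp
  have hev : ∀ ξ, fderiv ℝ (fun ξ : Rn n => Complex.exp (-(Complex.I * (inner ℝ y ξ : ℝ)))) ξ v =
      -(Complex.I * (inner ℝ y v : ℝ)) * Complex.exp (-(Complex.I * (inner ℝ y ξ : ℝ))) := fun ξ => by
    rw [(hed ξ).fderiv]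
    simp
    ring
  have hi := integrable_cexp_smul (schwartz_integrable_section f x h) y
  have hi' := integrable_cexp_smul (schwartz_integrable_section (∂_{fibreDir v} f) x h) y
  have key := integral_smul_fderiv_eq_neg_fderiv_smul_of_integrable (μ := volume) (v := v)
    (f := fun ξ : Rn n => Complex.exp (-(Complex.I * (inner ℝ y ξ : ℝ))))
    (g := fun ξ => f (x, ξ, h))
    (by
      simp only [hev, mul_smul]
      exact hi.smul (-(Complex.I * (inner ℝ y v : ℝ))))
    (by simpa only [hfd] using hi') hi (fun ξ _ => (hed ξ).differentiableAt)
    (fun ξ _ => (hd ξ).differentiableAt)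
  simp only [hfd, hev, mul_smul] at key
  rw [integral_smul, neg_smul, neg_neg] at key
  exact key

theorem one_add_norm_le_sum (y : Rn n) :
    1 + ‖y‖ ≤ 1 + ∑ j, |inner ℝ y (EuclideanSpace.single j (1 : ℝ))| := by
  gcongr
  calc ‖y‖ = ‖∑ j, y j • EuclideanSpace.single j (1 : ℝ)‖ := by
        congr 1
        ext i
        simp [Finset.sum_apply, Pi.single_apply]
    _ ≤ ∑ j, ‖y j • EuclideanSpace.single j (1 : ℝ)‖ := norm_sum_le _ _
    _ = _ := by
        refine Finset.sum_congr rfl fun j _ => ?_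
        simp [norm_smul, EuclideanSpace.inner_single_right]

theorem partialFourier_decay (N M : ℕ) : ∀ f : 𝓢(Rn n × Rn n × ℝ, E), ∃ C, 0 ≤ C ∧
    ∀ x y h, ‖partialFourier f x y h‖ * (1 + ‖y‖) ^ M ≤ C * decayWeight N x := by
  induction M with
  | zero => intro f; simpa using norm_partialFourier_le f N
  | succ M ih =>
    intro f
    obtain ⟨C, h0, hC⟩ := ih f
    choose D hD0 hD using fun j : Fin n => ih (∂_{fibreDir (EuclideanSpace.single j (1 : ℝ))} f)
    refine ⟨C + ∑ j, D j, add_nonneg h0 (Finset.sum_nonneg fun j _ => hD0 j), fun x y h => ?_⟩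
    calc ‖partialFourier f x y h‖ * (1 + ‖y‖) ^ (M + 1)
        = ‖partialFourier f x y h‖ * (1 + ‖y‖) ^ M * (1 + ‖y‖) := by ring
      _ ≤ ‖partialFourier f x y h‖ * (1 + ‖y‖) ^ M *
          (1 + ∑ j, |inner ℝ y (EuclideanSpace.single j (1 : ℝ))|) := by
          gcongr _ * ?_
          exact one_add_norm_le_sum y
      _ = ‖partialFourier f x y h‖ * (1 + ‖y‖) ^ M +
          ∑ j, ‖partialFourier (∂_{fibreDir (EuclideanSpace.single j (1 : ℝ))} f) x y h‖ *
            (1 + ‖y‖) ^ M := by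
          rw [mul_add, mul_one, Finset.mul_sum]
          congr 1
          refine Finset.sum_congr rfl fun j _ => ?_
          rw [partialFourier_lineDeriv_fibre, norm_smul, norm_mul, Complex.norm_I, one_mul,
            Complex.norm_real, Real.norm_eq_abs]
          ring
      _ ≤ C * decayWeight N x + ∑ j, D j * decayWeight N x := by
          exact add_le_add (hC x y h) (Finset.sum_le_sum fun j _ => hD j x y h)
      _ = _ := by rw [add_mul, Finset.sum_mul]

theorem hasDerivAt_partialFourier (f : 𝓢(Rn n × Rn n × ℝ, E)) (v x y : Rn n) (h t : ℝ) :
    HasDerivAt (fun t : ℝ => partialFourier f (x + t • v) y h)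
      (partialFourier (∂_{baseDir v} f) (x + t • v) y h) t := by
  obtain ⟨C, h0, hC⟩ := schwartz_bound (∂_{baseDir v} f) 0 (n + 1)
  have hf := f.continuous
  have hf' := (∂_{baseDir v} f).continuous
  refine (hasDerivAt_integral_of_dominated_loc_of_deriv_le (s := Set.univ)
    (bound := fun ξ => C * decayWeight (n + 1) ξ) (μ := volume)
    (F := fun (t : ℝ) ξ => Complex.exp (-(Complex.I * (inner ℝ y ξ : ℝ))) • f (x + t • v, ξ, h))
    (F' := fun (t : ℝ) ξ =>
      Complex.exp (-(Complex.I * (inner ℝ y ξ : ℝ))) • (∂_{baseDir v} f) (x + t • v, ξ, h))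
    univ_mem (Eventually.of_forall fun t => Continuous.aestronglyMeasurable (by fun_prop))
    (integrable_cexp_smul (schwartz_integrable_section f _ h) y)
    (Continuous.aestronglyMeasurable (by fun_prop))
    (ae_of_all _ fun ξ t _ => ?_)
    ((integrable_decayWeight (finrank_Rn_lt n) volume).const_mul C)
    (ae_of_all _ fun ξ t _ => ?_)).2
  · rw [norm_smul, norm_cexp_neg_I_mul, one_mul]
    exact (hC _ _ _).trans_eq (by simp [decayWeight])
  · refine HasDerivAt.const_smul _ ?_
    have h1 : HasDerivAt (fun t : ℝ => (x + t • v, ξ, h)) (baseDir v) t := by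
      have h2 : HasDerivAt (fun t : ℝ => x + t • v) v t := by
        simpa using ((hasDerivAt_id t).smul_const v).const_add x
      exact h2.prodMk ((hasDerivAt_const t ξ).prodMk (hasDerivAt_const t h))
    rw [SchwartzMap.lineDerivOp_apply_eq_fderiv]
    exact (f.hasFDerivAt (x + t • v, ξ, h)).comp_hasDerivAt t h1

end PartialFourier

section Rho

variable {n : ℕ} {F : Type*} [NormedAddCommGroup F] [InnerProductSpace ℂ F]

/-- The rapid family `(2π)⁻ⁿ f̂(x, y, h)`. -/
noncomputable def rhoFamily (f : 𝓢(Rn n × Rn n × ℝ, F →L[ℂ] F)) (x y : Rn n) (h : ℝ) :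
    F →L[ℂ] F := ((2 * Real.pi) ^ n)⁻¹ • partialFourier f x y h

theorem isRapidFamily_rhoFamily (f : 𝓢(Rn n × Rn n × ℝ, F →L[ℂ] F)) :
    IsRapidFamily (rhoFamily f) := by
  refine ⟨Continuous.fun_const_smul (continuous_partialFourier f) _, fun N => ?_⟩
  obtain ⟨C, h0, hC⟩ := partialFourier_decay N N f
  refine ⟨((2 * Real.pi) ^ n)⁻¹ * C, by positivity, fun x y h => ?_⟩
  rw [rhoFamily, norm_smul, Real.norm_of_nonneg (by positivity), mul_assoc]
  gcongr
  rw [← mul_assoc, decayWeight.eq_def N y, ← div_eq_mul_inv, le_div_iff₀ (by positivity)]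
  exact hC x y h

theorem actsBy_rho [CompleteSpace F] (f : 𝓢(Rn n × Rn n × ℝ, F →L[ℂ] F)) :
    ActsBy (fun h => rho h f) (rhoFamily f) := fun h hh φ x => by
  rw [rho_apply hh, ← integral_smul]
  rfl

theorem isDecayingKernel_slice (f : 𝓢(Rn n × Rn n × ℝ, F →L[ℂ] F)) (h : ℝ) :
    IsDecayingKernel fun x ξ => f (x, ξ, h) := by
  obtain ⟨C, h0, hC⟩ := schwartz_bound f (n + 1) (n + 1)
  exact ⟨f.continuous.comp (f := fun p : Rn n × Rn n => (p.1, p.2, h)) (by fun_prop), C,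
    fun x ξ => hC x ξ h⟩

theorem symbolAtZero_rhoFamily [CompleteSpace F] (f : 𝓢(Rn n × Rn n × ℝ, F →L[ℂ] F)) :
    symbolAtZero (rhoFamily f) = fun x ξ => f (x, ξ, 0) := by
  funext x ξ
  have hi := (isRapidFamily_rhoFamily f).integrable_right x 0
  have hi' : Integrable fun y => partialFourier f x y 0 := by
    have := hi.smul ((2 * Real.pi) ^ n)
    refine this.congr (ae_of_all _ fun y => ?_)
    simp only [rhoFamily, Pi.smul_apply]
    rw [smul_inv_smul₀ (by positivity)]
  have hf := f.continuous
  have := fourier_inversion_exp (H := fun ξ => f (x, ξ, 0)) (by fun_prop)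
    (schwartz_integrable_section f x 0) hi' ξ
  simp only [symbolAtZero, rhoFamily]
  simp_rw [smul_comm _ (((2 * Real.pi) ^ n)⁻¹ : ℝ)]
  rw [integral_smul, inv_smul_eq_iff₀ (by positivity)]
  exact this

theorem isQuantization_rho [CompleteSpace F] (f : 𝓢(Rn n × Rn n × ℝ, F →L[ℂ] F)) :
    IsQuantization (fun h => rho h f) (fun x ξ => f (x, ξ, 0)) :=
  ⟨isDecayingKernel_slice f 0, rhoFamily f, isRapidFamily_rhoFamily f, actsBy_rho f,
    symbolAtZero_rhoFamily f⟩

theorem rhoFamily_lineDeriv_fibre (f : 𝓢(Rn n × Rn n × ℝ, F →L[ℂ] F)) (v x y : Rn n) (h : ℝ) :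
    rhoFamily (∂_{fibreDir v} f) x y h = (Complex.I * (inner ℝ y v : ℝ)) • rhoFamily f x y h := by
  rw [rhoFamily, rhoFamily, partialFourier_lineDeriv_fibre, smul_comm]

theorem hasDerivAt_rhoFamily (f : 𝓢(Rn n × Rn n × ℝ, F →L[ℂ] F)) (v x y : Rn n) (h t : ℝ) :
    HasDerivAt (fun t : ℝ => rhoFamily f (x + t • v) y h)
      (rhoFamily (∂_{baseDir v} f) (x + t • v) y h) t :=
  (hasDerivAt_partialFourier f v x y h t).fun_const_smul _

theorem exists_norm_le (φ : 𝓢(Rn n, F)) : ∃ M, 0 ≤ M ∧ ∀ x, ‖φ x‖ ≤ M := by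
  obtain ⟨C, hC⟩ := φ.decay 0 0
  exact ⟨C, hC.1.le, fun x => by simpa using hC.2 x⟩

theorem IsRapidFamily.integrable_apply {k : Rn n → Rn n → ℝ → F →L[ℂ] F} (hk : IsRapidFamily k)
    (φ : 𝓢(Rn n, F)) (x : Rn n) (h : ℝ) : Integrable fun y => k x y h (φ (x + h • y)) := by
  obtain ⟨M, h0, hM⟩ := exists_norm_le φ
  have hc : Continuous fun y => φ (x + h • y) := by have := φ.continuous; fun_prop
  exact ((hk.integrable_right x h).norm.mul_const M).mono'
    (isBoundedBilinearMap_apply.continuous.comp_aestronglyMeasurable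
      ((hk.integrable_right x h).aestronglyMeasurable.prodMk hc.aestronglyMeasurable))
    (ae_of_all _ fun y => (ContinuousLinearMap.le_opNorm _ _).trans (by gcongr; exact hM _))

/-- The commutator of a coordinate with a quantized operator. -/
theorem lie_coordMul_rho [CompleteSpace F] (f : 𝓢(Rn n × Rn n × ℝ, F →L[ℂ] F)) (v : Rn n)
    {h : ℝ} (hh : 0 < h) :
    ⁅coordMul (F := F) v, rho h f⁆ = (Complex.I * h) • rho h (∂_{fibreDir v} f) := by
  refine LinearMap.ext fun φ => SchwartzMap.ext fun x => ?_
  have h1 := (isRapidFamily_rhoFamily f).integrable_apply φ x h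
  have h2 := (isRapidFamily_rhoFamily f).integrable_apply (coordMul v φ) x h
  rw [Ring.lie_def]
  change coordMul v (rho h f φ) x - rho h f (coordMul v φ) x =
    (Complex.I * h) • rho h (∂_{fibreDir v} f) φ x
  rw [coordMul_apply, actsBy_rho f h hh, actsBy_rho f h hh, actsBy_rho _ h hh, ← integral_smul,
    ← integral_smul, ← integral_sub (h1.fun_smul _) h2]
  refine integral_congr_ae (ae_of_all _ fun y => ?_)
  simp only [coordMul_apply, rhoFamily_lineDeriv_fibre, map_smul, smul_apply]
  rw [← sub_smul, smul_smul]
  congr 1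
  rw [inner_add_right, inner_smul_right, real_inner_comm v y]
  push_cast
  linear_combination (-(h : ℂ) * (inner ℝ v y : ℝ)) * Complex.I_sq

/-- The commutator of a derivative with a quantized operator. -/
theorem lie_lineDeriv_rho [CompleteSpace F] (f : 𝓢(Rn n × Rn n × ℝ, F →L[ℂ] F)) (v : Rn n)
    {h : ℝ} (hh : 0 < h) :
    ⁅(LineDeriv.lineDerivOpCLM ℂ 𝓢(Rn n, F) v).toLinearMap, rho h f⁆ = rho h (∂_{baseDir v} f) := by
  refine LinearMap.ext fun φ => SchwartzMap.ext fun x => ?_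
  rw [Ring.lie_def]
  change (∂_{v} (rho h f φ)) x - rho h f (∂_{v} φ) x = rho h (∂_{baseDir v} f) φ x
  rw [sub_eq_iff_eq_add, SchwartzMap.lineDerivOp_apply]
  refine HasLineDerivAt.lineDeriv ?_
  have hR := isRapidFamily_rhoFamily f
  have hR' := isRapidFamily_rhoFamily (∂_{baseDir v} f)
  obtain ⟨M, hM0, hM⟩ := exists_norm_le φ
  obtain ⟨M', hM0', hM'⟩ := exists_norm_le (∂_{v} φ)
  obtain ⟨C, hC0, hC⟩ := hR.bound (n + 1)
  obtain ⟨C', hC0', hC'⟩ := hR'.bound (n + 1)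
  have key := (hasDerivAt_integral_of_dominated_loc_of_deriv_le (s := Set.univ) (x₀ := (0 : ℝ))
    (bound := fun y => (C' * M + C * M') * decayWeight (n + 1) y) (μ := volume)
    (F := fun (t : ℝ) y => rhoFamily f (x + t • v) y h (φ (x + t • v + h • y)))
    (F' := fun (t : ℝ) y =>
      rhoFamily (∂_{baseDir v} f) (x + t • v) y h (φ (x + t • v + h • y)) +
      rhoFamily f (x + t • v) y h ((∂_{v} φ) (x + t • v + h • y)))
    univ_mem (Eventually.of_forall fun t => (hR.integrable_apply φ _ h).aestronglyMeasurable)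
    (hR.integrable_apply φ _ h)
    ((hR'.integrable_apply φ _ h).add (hR.integrable_apply (∂_{v} φ) _ h)).aestronglyMeasurable
    (ae_of_all _ fun y t _ => ?_)
    ((integrable_decayWeight (finrank_Rn_lt n) volume).const_mul _)
    (ae_of_all _ fun y t _ => ?_)).2
  · simp only [zero_smul, add_zero] at key
    rw [integral_add (hR'.integrable_apply φ _ h) (hR.integrable_apply (∂_{v} φ) _ h)] at key
    rw [HasLineDerivAt, actsBy_rho _ h hh, actsBy_rho f h hh]
    refine key.congr_of_eventuallyEq (Eventually.of_forall fun t => ?_)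
    exact actsBy_rho f h hh φ _
  · have p1 := decayWeight_nonneg (n + 1) (x + t • v)
    have p2 := decayWeight_nonneg (n + 1) y
    have b1 : ∀ {D : ℝ}, 0 ≤ D → D * (decayWeight (n + 1) (x + t • v) * decayWeight (n + 1) y) ≤
        D * decayWeight (n + 1) y := fun {D} hD => by
      gcongr
      exact mul_le_of_le_one_left p2 (decayWeight_le_one _ _)
    refine (norm_add_le _ _).trans ?_
    rw [add_mul]
    refine add_le_add ((ContinuousLinearMap.le_opNorm _ _).trans ?_)
      ((ContinuousLinearMap.le_opNorm _ _).trans ?_)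
    · rw [mul_right_comm]
      gcongr
      · exact (hC' _ _ _).trans (b1 hC0')
      · exact hM _
    · rw [mul_right_comm]
      gcongr
      · exact (hC _ _ _).trans (b1 hC0)
      · exact hM' _
  · have h1 := hasDerivAt_rhoFamily f v x y h t
    have h2 : HasDerivAt (fun t : ℝ => φ (x + t • v + h • y))
        ((∂_{v} φ) (x + t • v + h • y)) t := by
      have h3 : HasDerivAt (fun t : ℝ => x + t • v + h • y) v t := by
        simpa using (((hasDerivAt_id t).smul_const v).const_add x).add_const (h • y)
      rw [SchwartzMap.lineDerivOp_apply_eq_fderiv]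
      exact (φ.hasFDerivAt (x + t • v + h • y)).comp_hasDerivAt t h3
    exact ((ContinuousLinearMap.restrictScalarsL ℂ F F ℝ ℝ).hasFDerivAt.comp_hasDerivAt t h1).clm_apply h2

end Rho

section Geometry

variable {n d r : ℕ}

/-- The inclusion of a subspace in orthonormal coordinates. -/
noncomputable def coordIncl {K : Submodule ℝ (Rn n)} (b : OrthonormalBasis (Fin d) ℝ K) :
    Rn d →ₗᵢ[ℝ] Rn n := K.subtypeₗᵢ.comp b.repr.symm.toLinearIsometry

theorem coordIncl_apply {K : Submodule ℝ (Rn n)} (b : OrthonormalBasis (Fin d) ℝ K) (s : Rn d) :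
    coordIncl b s = (b.repr.symm s : Rn n) := rfl

theorem inner_coordIncl_orthogonal {K : Submodule ℝ (Rn n)} (b : OrthonormalBasis (Fin d) ℝ K)
    (b' : OrthonormalBasis (Fin r) ℝ Kᗮ) (s : Rn d) (w : Rn r) :
    inner ℝ (coordIncl b s) (coordIncl b' w) = 0 :=
  Submodule.inner_right_of_mem_orthogonal (b.repr.symm s).2 (b'.repr.symm w).2

theorem norm_le_norm_coordIncl_add {K : Submodule ℝ (Rn n)} (b : OrthonormalBasis (Fin d) ℝ K)
    (b' : OrthonormalBasis (Fin r) ℝ Kᗮ) (s : Rn d) (w : Rn r) :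
    ‖s‖ ≤ ‖coordIncl b s + coordIncl b' w‖ := by
  have h := norm_add_sq_eq_norm_sq_add_norm_sq_real (inner_coordIncl_orthogonal b b' s w)
  rw [(coordIncl b).norm_map] at h
  nlinarith [norm_nonneg s, norm_nonneg (coordIncl b s + coordIncl b' w),
    mul_self_nonneg ‖coordIncl b' w‖]

theorem measurePreserving_coordIncl_add {K : Submodule ℝ (Rn n)}
    (b : OrthonormalBasis (Fin d) ℝ K) (b' : OrthonormalBasis (Fin r) ℝ Kᗮ) :
    MeasurePreserving (fun p : Rn d × Rn r => coordIncl b p.1 + coordIncl b' p.2) := by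
  let e : WithLp 2 (Rn d × Rn r) ≃ₗᵢ[ℝ] Rn n :=
    (LinearIsometryEquiv.withLpProdCongr 2 b.repr.symm b'.repr.symm).trans
      K.orthogonalDecomposition.symm
  have h1 := e.measurePreserving
  have h2 : MeasurePreserving (WithLp.toLp 2 : Rn d × Rn r → WithLp 2 (Rn d × Rn r)) :=
    (WithLp.volume_preserving_ofLp (Rn d) (Rn r)).symm (MeasurableEquiv.toLp 2 (Rn d × Rn r)).symm
  exact h1.comp h2

theorem measurableEmbedding_coordIncl_add {K : Submodule ℝ (Rn n)}
    (b : OrthonormalBasis (Fin d) ℝ K) (b' : OrthonormalBasis (Fin r) ℝ Kᗮ) :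
    MeasurableEmbedding (fun p : Rn d × Rn r => coordIncl b p.1 + coordIncl b' p.2) := by
  let e : WithLp 2 (Rn d × Rn r) ≃ₗᵢ[ℝ] Rn n :=
    (LinearIsometryEquiv.withLpProdCongr 2 b.repr.symm b'.repr.symm).trans
      K.orthogonalDecomposition.symm
  exact e.toHomeomorph.measurableEmbedding.comp (MeasurableEquiv.toLp 2 (Rn d × Rn r)).measurableEmbedding

variable {G : Subgroup (Matrix.specialOrthogonalGroup (Fin n) ℝ)}

theorem det_act (g : G) : LinearMap.det (act g).toLinearMap = 1 := by
  have h : (act g).toLinearMap = Matrix.toLin (EuclideanSpace.basisFun (Fin n) ℝ).toBasis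
      (EuclideanSpace.basisFun (Fin n) ℝ).toBasis
      ((g : Matrix.specialOrthogonalGroup (Fin n) ℝ) : Matrix (Fin n) (Fin n) ℝ) := by
    rfl
  rw [h, LinearMap.det_toLin]
  exact (Matrix.mem_specialOrthogonalGroup_iff.1
      (g : Matrix.specialOrthogonalGroup (Fin n) ℝ).2).2

theorem act_mem_normal (g : G) : ∀ v ∈ (fixedSpace g)ᗮ, (act g).toLinearMap v ∈ (fixedSpace g)ᗮ :=
  fun v hv => by
    have := Submodule.add_mem _ (act_sub_one_mem_normal g v hv) hv
    simpa using this

theorem det_act_normal (g : G) :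
    LinearMap.det ((act g).toLinearMap.restrict (act_mem_normal g)) = 1 := by
  have h := LinearMap.det_eq_det_mul_det (fixedSpace g)ᗮ (act g).toLinearMap (act_mem_normal g)
  have hq : (fixedSpace g)ᗮ.mapQ (fixedSpace g)ᗮ (act g).toLinearMap (act_mem_normal g) =
      LinearMap.id := by
    refine Submodule.linearMap_qext _ (LinearMap.ext fun x => ?_)
    simp only [LinearMap.comp_apply, Submodule.mapQ_apply, Submodule.mkQ_apply, LinearMap.id_apply]
    rw [Submodule.Quotient.eq, Submodule.mem_orthogonal]
    intro u hu
    have h1 := inner_act_act g u x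
    rw [(mem_fixedSpace g u).1 hu] at h1
    change inner ℝ u (act g x - x) = 0
    rw [inner_sub_right, h1, sub_self]
  rw [hq, LinearMap.det_id, mul_one, det_act] at h
  exact h.symm

theorem detNormal_pos (g : G) : 0 < detNormal g := by
  let N := (fixedSpace g)ᗮ
  let A : N →ₗ[ℝ] N := (act g).toLinearMap.restrict (act_mem_normal g)
  let f : ℝ → ℝ := fun t => LinearMap.det (A - t • LinearMap.id)
  have hf : Continuous f := by
    let β := Module.finBasis ℝ N
    have : f = fun t => (LinearMap.toMatrix β β A - t • LinearMap.toMatrix β β LinearMap.id).det := by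
      funext t
      rw [← map_smul, ← map_sub, LinearMap.det_toMatrix]
    rw [this]
    fun_prop
  have h0 : f 0 = 1 := by simpa [f] using det_act_normal g
  have h1 : f 1 = detNormal g := by
    simp only [f, one_smul]
    rfl
  have hne : ∀ t ∈ Set.Icc (0 : ℝ) 1, f t ≠ 0 := by
    intro t ht h
    obtain ⟨v, hv, hv0⟩ := (LinearMap.bot_lt_ker_of_det_eq_zero h).ne' |> (Submodule.ne_bot_iff _).1
    have hA : act g (v : Rn n) = t • (v : Rn n) := by
      have := LinearMap.mem_ker.1 hv
      rw [LinearMap.sub_apply, sub_eq_zero] at this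
      exact congrArg Subtype.val this
    have hn := norm_act g (v : Rn n)
    rw [hA, norm_smul, Real.norm_of_nonneg ht.1] at hn
    have hv' : ‖(v : Rn n)‖ ≠ 0 := by simpa using hv0
    have ht1 : t = 1 := by
      have := mul_right_cancel₀ hv' (hn.trans (one_mul _).symm)
      exact this
    rw [ht1, one_smul] at hA
    have hm : (v : Rn n) ∈ fixedSpace g := (mem_fixedSpace g _).2 hA
    have := Submodule.inner_right_of_mem_orthogonal hm v.2
    rw [inner_self_eq_zero] at this
    exact hv' (by rw [this, norm_zero])
  rw [← h1]
  by_contra hneg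
  obtain ⟨t, ht, ht0⟩ := intermediate_value_Icc' (zero_le_one) hf.continuousOn
    (show (0 : ℝ) ∈ Set.Icc (f 1) (f 0) from ⟨not_lt.1 hneg, by rw [h0]; exact zero_le_one⟩)
  exact hne t ht ht0

/-- `g - 1` on the orthogonal complement of the fixed space, in orthonormal coordinates. -/
noncomputable def normalMap (g : G) (b' : OrthonormalBasis (Fin r) ℝ (fixedSpace g)ᗮ) :
    Rn r →ₗ[ℝ] Rn r :=
  b'.repr.toLinearEquiv.toLinearMap ∘ₗ
    (((act g).toLinearMap - LinearMap.id : Rn n →ₗ[ℝ] Rn n).restrict (act_sub_one_mem_normal g)) ∘ₗ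
    b'.repr.symm.toLinearEquiv.toLinearMap

theorem det_normalMap (g : G) (b' : OrthonormalBasis (Fin r) ℝ (fixedSpace g)ᗮ) :
    LinearMap.det (normalMap g b') = detNormal g :=
  LinearMap.det_conj _ b'.repr.toLinearEquiv

theorem act_coordIncl_add_sub (g : G) (b : OrthonormalBasis (Fin d) ℝ (fixedSpace g))
    (b' : OrthonormalBasis (Fin r) ℝ (fixedSpace g)ᗮ) (s : Rn d) (w : Rn r) :
    act g (coordIncl b s + coordIncl b' w) - (coordIncl b s + coordIncl b' w) =
      coordIncl b' (normalMap g b' w) := by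
  have h1 : act g (coordIncl b s) = coordIncl b s := (mem_fixedSpace g _).1 (b.repr.symm s).2
  rw [map_add, h1, add_sub_add_left_eq_sub]
  simp [coordIncl_apply, normalMap]

theorem normalMap_bound (g : G) (b' : OrthonormalBasis (Fin r) ℝ (fixedSpace g)ᗮ) :
    ∃ κ, 1 ≤ κ ∧ ∀ w, ‖w‖ ≤ κ * ‖normalMap g b' w‖ := by
  have hdet : LinearMap.det (normalMap g b') ≠ 0 := by
    rw [det_normalMap]; exact (detNormal_pos g).ne'
  obtain ⟨κ, h0, hκ⟩ := (normalMap g b').exists_antilipschitzWith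
    (not_not.1 fun h => hdet (LinearMap.det_eq_zero_iff_ker_ne_bot.2 h))
  refine ⟨max 1 κ, le_max_left _ _, fun w => ?_⟩
  have := hκ.le_mul_dist w 0
  rw [map_zero, dist_zero_right, dist_zero_right] at this
  refine this.trans ?_
  gcongr
  exact le_max_right _ _

theorem integral_comp_normalMap {E : Type*} [NormedAddCommGroup E] [NormedSpace ℝ E] (g : G)
    (b' : OrthonormalBasis (Fin r) ℝ (fixedSpace g)ᗮ) {H : Rn r → E} (hH : Continuous H) :
    ∫ w, H (normalMap g b' w) = (detNormal g)⁻¹ • ∫ v, H v := by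
  have hpos := detNormal_pos g
  have hdet : LinearMap.det (normalMap g b') ≠ 0 := by
    rw [det_normalMap]; exact hpos.ne'
  have h := Measure.map_linearMap_addHaar_eq_smul_addHaar (volume : Measure (Rn r)) hdet
  have hc : Continuous (normalMap g b') := LinearMap.continuous_of_finiteDimensional _
  rw [← integral_map hc.aemeasurable hH.aestronglyMeasurable, h, integral_smul_measure,
    det_normalMap, abs_of_pos (inv_pos.2 hpos), ENNReal.toReal_ofReal (inv_pos.2 hpos).le]

end Geometry

section Limit

variable {n d r : ℕ} {F : Type*} [NormedAddCommGroup F] [InnerProductSpace ℂ F]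

theorem finrank_lt_of_basis {K : Submodule ℝ (Rn n)} (b : OrthonormalBasis (Fin d) ℝ K) :
    Module.finrank ℝ (Rn d) < n + 1 := by
  have h1 := Module.finrank_eq_card_basis b.toBasis
  have h2 := K.finrank_le
  simp only [Fintype.card_fin, finrank_euclideanSpace_fin] at h1 h2 ⊢
  omega

/-- Integrating a rapid family over a subspace in the second variable amounts to integrating its
symbol over the orthogonal complement. -/
theorem IsRapidFamily.integral_coordIncl [CompleteSpace F] {c : Rn n → Rn n → ℝ → F →L[ℂ] F}
    (hc : IsRapidFamily c)
    {K : Submodule ℝ (Rn n)} (b : OrthonormalBasis (Fin d) ℝ K)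
    (b' : OrthonormalBasis (Fin r) ℝ Kᗮ) (x : Rn n)
    (hs : Integrable fun η => symbolAtZero c x (coordIncl b η)) :
    (2 * Real.pi) ^ d • ∫ v, c x (coordIncl b' v) 0 =
      ∫ η, symbolAtZero c x (coordIncl b η) := by
  obtain ⟨C, h0, hC⟩ := hc.bound ((n + 1) + (n + 1))
  have hcx : Continuous fun y => c x y 0 :=
    hc.cont.comp (f := fun y : Rn n => (x, y, (0 : ℝ))) (by fun_prop)
  have hbd : ∀ (u : Rn d) (v : Rn r), ‖c x (coordIncl b u + coordIncl b' v) 0‖ ≤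
      C * (decayWeight (n + 1) u * decayWeight (n + 1) v) := fun u v => by
    set z := coordIncl b u + coordIncl b' v
    have hv : ‖v‖ ≤ ‖z‖ := by
      have h := norm_add_sq_eq_norm_sq_add_norm_sq_real (inner_coordIncl_orthogonal b b' u v)
      rw [(coordIncl b').norm_map] at h
      nlinarith [norm_nonneg v, norm_nonneg z, mul_self_nonneg ‖coordIncl b u‖]
    have p1 := decayWeight_nonneg (n + 1) z
    have p2 := decayWeight_nonneg (n + 1) u
    calc _ ≤ C * (decayWeight ((n + 1) + (n + 1)) x * decayWeight ((n + 1) + (n + 1)) z) := hC _ _ _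
      _ ≤ C * (1 * (decayWeight (n + 1) z * decayWeight (n + 1) z)) := by
          rw [← decayWeight_add_exponent]
          have := decayWeight_nonneg ((n + 1) + (n + 1)) z
          gcongr
          exact decayWeight_le_one _ _
      _ ≤ C * (decayWeight (n + 1) u * decayWeight (n + 1) v) := by
          rw [one_mul]
          gcongr
          · exact decayWeight_le_of_norm_le _ (norm_le_norm_coordIncl_add b b' u v)
          · exact decayWeight_le_of_norm_le _ hv
  have hwd := integrable_decayWeight (finrank_lt_of_basis b) (volume : Measure (Rn d))
  have hwr := integrable_decayWeight (finrank_lt_of_basis b') (volume : Measure (Rn r))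
  have hcont : Continuous fun p : Rn d × Rn r => c x (coordIncl b p.1 + coordIncl b' p.2) 0 :=
    hcx.comp (((coordIncl b).continuous.comp continuous_fst).add
      ((coordIncl b').continuous.comp continuous_snd))
  let g : Rn d → F →L[ℂ] F := fun u => ∫ v, c x (coordIncl b u + coordIncl b' v) 0
  have hint : Integrable (fun p : Rn d × Rn r => c x (coordIncl b p.1 + coordIncl b' p.2) 0)
      (volume.prod volume) :=
    ((hwd.mul_prod hwr).const_mul C).mono' hcont.aestronglyMeasurable
      (ae_of_all _ fun p => hbd p.1 p.2)
  have hg_int : Integrable g := hint.integral_prod_left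
  have hg_cont : Continuous g := by
    refine continuous_of_dominated (bound := fun v => C * decayWeight (n + 1) v)
      (fun u => (hcont.comp (f := fun v : Rn r => (u, v)) (by fun_prop)).aestronglyMeasurable)
      (fun u => ae_of_all _ fun v => (hbd u v).trans ?_) (hwr.const_mul C)
      (ae_of_all _ fun v => hcont.comp (f := fun u : Rn d => (u, v)) (by fun_prop))
    have := decayWeight_nonneg (n + 1) v
    gcongr
    exact mul_le_of_le_one_left this (decayWeight_le_one _ _)
  have hsym : ∀ η : Rn d, symbolAtZero c x (coordIncl b η) =
      ∫ u, Complex.exp (-(Complex.I * (inner ℝ (-η) u : ℝ))) • g u := fun η => by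
    rw [symbolAtZero, ← (measurePreserving_coordIncl_add b b').integral_comp
      (measurableEmbedding_coordIncl_add b b'), Measure.volume_eq_prod, integral_prod]
    · refine integral_congr_ae (ae_of_all _ fun u => ?_)
      simp only [g, ← integral_smul]
      refine integral_congr_ae (ae_of_all _ fun v => ?_)
      simp only [inner_add_left, (coordIncl b).inner_map_map, inner_neg_left]
      rw [real_inner_comm (coordIncl b η), inner_coordIncl_orthogonal, real_inner_comm η u]
      simp
    · have he : Continuous fun p : Rn d × Rn r => Complex.exp (Complex.I *
          (inner ℝ (coordIncl b p.1 + coordIncl b' p.2) (coordIncl b η) : ℝ)) := by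
        have := (coordIncl b).continuous
        have := (coordIncl b').continuous
        fun_prop
      refine hint.norm.mono' (he.smul hcont).aestronglyMeasurable (ae_of_all _ fun p => ?_)
      rw [norm_smul, norm_cexp_I_mul, one_mul]
  have hs' : Integrable fun η => ∫ u, Complex.exp (-(Complex.I * (inner ℝ η u : ℝ))) • g u := by
    have := hs.comp_neg
    simpa only [hsym, neg_neg] using this
  have key := fourier_inversion_exp hg_cont hg_int hs' 0
  simp only [inner_zero_right, Complex.ofReal_zero, mul_zero, Complex.exp_zero, one_smul] at key
  rw [← integral_neg_eq_self] at key
  simp_rw [← hsym] at key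
  rw [key]
  simp [g]

theorem IsDecayingKernel.integrable_coordIncl {P : Rn n → Rn n → F →L[ℂ] F}
    (hP : IsDecayingKernel P) {K : Submodule ℝ (Rn n)} (b : OrthonormalBasis (Fin d) ℝ K) :
    Integrable (fun p : Rn d × Rn d => P (coordIncl b p.1) (coordIncl b p.2)) := by
  obtain ⟨D, hD0, hD⟩ := hP.exists_bound
  have hwd := integrable_decayWeight (finrank_lt_of_basis b) (volume : Measure (Rn d))
  have hbc := (coordIncl b).continuous
  refine ((hwd.mul_prod hwd).const_mul D).mono' (hP.cont.comp
    (f := fun p : Rn d × Rn d => (coordIncl b p.1, coordIncl b p.2))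
    (by fun_prop)).aestronglyMeasurable (ae_of_all _ fun p => (hD _ _).trans_eq ?_)
  simp [decayWeight, (coordIncl b).norm_map]

variable {G : Subgroup (Matrix.specialOrthogonalGroup (Fin n) ℝ)}

/-- Localization of the trace integral at the fixed-point set. -/
theorem IsRapidFamily.tendsto_trace [CompleteSpace F] [FiniteDimensional ℂ F]
    {c : Rn n → Rn n → ℝ → F →L[ℂ] F} (hc : IsRapidFamily c)
    (hs : IsDecayingKernel (symbolAtZero c)) (g : G) (γ : F →L[ℂ] F)
    (b : OrthonormalBasis (Fin d) ℝ (fixedSpace g)) :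
    Tendsto (fun h : ℝ => (h ^ d) • ∫ y, traceCLM F (γ * scaledKernel c h y (act g y)))
      (𝓝[>] 0) (𝓝 (((2 * Real.pi) ^ d * detNormal g)⁻¹ • ∫ p : Rn d × Rn d,
        traceCLM F (γ * symbolAtZero c (coordIncl b p.1) (coordIncl b p.2)))) := by
  let b' := stdOrthonormalBasis ℝ ((fixedSpace g)ᗮ : Submodule ℝ (Rn n))
  set r := Module.finrank ℝ ((fixedSpace g)ᗮ : Submodule ℝ (Rn n)) with hr
  let tr : (F →L[ℂ] F) →L[ℂ] ℂ := traceCLM F ∘L ContinuousLinearMap.mul ℂ (F →L[ℂ] F) γ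
  have htr : ∀ A, traceCLM F (γ * A) = tr A := fun A => rfl
  simp_rw [htr]
  have hdr : n = d + r := by
    have h1 := Module.finrank_eq_card_basis b.toBasis
    have h2 := (fixedSpace g).finrank_add_finrank_orthogonal
    rw [h1, ← hr] at h2
    simpa using h2.symm
  let J : ℝ → Rn d × Rn r → ℂ := fun h p =>
    tr (c (coordIncl b p.1 + h • coordIncl b' p.2) (coordIncl b' (normalMap g b' p.2)) h)
  obtain ⟨C, h0, hC⟩ := hc.bound (n + 1)
  obtain ⟨κ, hκ1, hκ⟩ := normalMap_bound g b'
  have hM : Continuous (normalMap g b') := LinearMap.continuous_of_finiteDimensional _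
  have hbc := (coordIncl b).continuous
  have hbc' := (coordIncl b').continuous
  have hwd := integrable_decayWeight (finrank_lt_of_basis b) (volume : Measure (Rn d))
  have hwr := integrable_decayWeight (finrank_lt_of_basis b') (volume : Measure (Rn r))
  have hJc : Continuous fun q : ℝ × Rn d × Rn r => J q.1 q.2 :=
    tr.continuous.comp (hc.cont.comp (f := fun q : ℝ × Rn d × Rn r =>
      (coordIncl b q.2.1 + q.1 • coordIncl b' q.2.2, coordIncl b' (normalMap g b' q.2.2), q.1))
      (by fun_prop))
  have hJb : ∀ h p, ‖J h p‖ ≤ ‖tr‖ * C * κ ^ (n + 1) *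
      (decayWeight (n + 1) p.1 * decayWeight (n + 1) p.2) := fun h p => by
    have p1 := decayWeight_nonneg (n + 1) p.1
    have p2 := decayWeight_nonneg (n + 1) (coordIncl b' (normalMap g b' p.2))
    have e1 : decayWeight (n + 1) (coordIncl b p.1 + h • coordIncl b' p.2) ≤
        decayWeight (n + 1) p.1 := by
      rw [← map_smul]
      exact decayWeight_le_of_norm_le _ (norm_le_norm_coordIncl_add b b' _ _)
    have e2 : decayWeight (n + 1) (coordIncl b' (normalMap g b' p.2)) ≤
        κ ^ (n + 1) * decayWeight (n + 1) p.2 := by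
      unfold decayWeight
      rw [← div_eq_mul_inv, le_div_iff₀ (by positivity), inv_mul_le_iff₀ (by positivity), ← mul_pow,
        (coordIncl b').norm_map]
      gcongr
      nlinarith [hκ p.2]
    calc ‖J h p‖ ≤ ‖tr‖ * (C * (decayWeight (n + 1) p.1 *
          (κ ^ (n + 1) * decayWeight (n + 1) p.2))) := by
          refine (tr.le_opNorm _).trans ?_
          gcongr
          refine (hC _ _ _).trans ?_
          gcongr
      _ = _ := by ring
  have hbound := (hwd.mul_prod hwr).const_mul (‖tr‖ * C * κ ^ (n + 1))
  have hJm : ∀ h, AEStronglyMeasurable (J h) (volume.prod volume) := fun h =>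
    (hJc.comp (f := fun p : Rn d × Rn r => (h, p)) (by fun_prop)).aestronglyMeasurable
  have hJi : ∀ h, Integrable (J h) (volume.prod volume) := fun h =>
    hbound.mono' (hJm h) (ae_of_all _ (hJb h))
  have hscale : ∀ h : ℝ, 0 < h → h ^ d • ∫ y, tr (scaledKernel c h y (act g y)) =
      ∫ p, J h p ∂(volume.prod volume) := by
    intro h hh
    have hZ : Integrable fun y => tr (scaledKernel c h y (act g y)) := by
      have hk := hc.isDecayingKernel hh
      obtain ⟨C', h0', hC'⟩ := hk.exists_bound
      refine ((integrable_decayWeight (finrank_Rn_lt n) volume).const_mul (‖tr‖ * C')).mono' ?_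
        (ae_of_all _ fun y => (tr.le_opNorm _).trans ?_)
      · exact (tr.continuous.comp (hk.cont.comp (f := fun y : Rn n => (y, act g y))
          (by fun_prop))).aestronglyMeasurable
      · rw [mul_assoc]
        gcongr
        refine (hC' _ _).trans ?_
        have := decayWeight_nonneg (n + 1) y
        gcongr
        exact mul_le_of_le_one_right this (decayWeight_le_one _ _)
    have hmp := measurePreserving_coordIncl_add b b'
    have hme := measurableEmbedding_coordIncl_add b b'
    have hZ' : Integrable (fun p : Rn d × Rn r => tr (scaledKernel c h
        (coordIncl b p.1 + coordIncl b' p.2) (act g (coordIncl b p.1 + coordIncl b' p.2))))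
        (volume.prod volume) := (hmp.integrable_comp_emb hme).2 hZ
    rw [← hmp.integral_comp hme, Measure.volume_eq_prod, integral_prod _ hZ',
      integral_prod _ (hJi h), ← integral_smul]
    refine integral_congr_ae (ae_of_all _ fun s => ?_)
    simp only
    have h1 := Measure.integral_comp_smul_of_nonneg (volume : Measure (Rn r))
      (fun w => tr (scaledKernel c h (coordIncl b s + coordIncl b' w)
        (act g (coordIncl b s + coordIncl b' w)))) h (hR := hh.le)
    rw [finrank_euclideanSpace_fin, eq_inv_smul_iff₀ (by positivity)] at h1
    rw [← h1, smul_smul, ← pow_add, ← hdr, ← integral_smul]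
    refine integral_congr_ae (ae_of_all _ fun w => ?_)
    have e : h⁻¹ • (act g (coordIncl b s + coordIncl b' (h • w)) -
        (coordIncl b s + coordIncl b' (h • w))) = coordIncl b' (normalMap g b' w) := by
      rw [act_coordIncl_add_sub, map_smul (normalMap g b'), map_smul (coordIncl b'),
        inv_smul_smul₀ hh.ne']
    simp only [scaledKernel, J]
    rw [e, map_smul (coordIncl b'), ContinuousLinearMap.map_smul_of_tower, smul_smul, mul_inv_cancel₀ (by positivity), one_smul]
  have hlim : Tendsto (fun h : ℝ => ∫ p, J h p ∂(volume.prod volume)) (𝓝[>] 0)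
      (𝓝 (∫ p, J 0 p ∂(volume.prod volume))) := by
    refine tendsto_integral_filter_of_dominated_convergence _ (Eventually.of_forall hJm)
      (Eventually.of_forall fun h => ae_of_all _ (hJb h)) hbound (ae_of_all _ fun p => ?_)
    exact ((hJc.comp (f := fun h : ℝ => (h, p)) (by fun_prop)).tendsto 0).mono_left
      nhdsWithin_le_nhds
  have hJ0 : ∫ p, J 0 p ∂(volume.prod volume) = ((2 * Real.pi) ^ d * detNormal g)⁻¹ •
      ∫ p : Rn d × Rn d, tr (symbolAtZero c (coordIncl b p.1) (coordIncl b p.2)) := by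
    obtain ⟨D, hD0, hD⟩ := hs.exists_bound
    have hsc : Continuous fun p : Rn d × Rn d =>
        symbolAtZero c (coordIncl b p.1) (coordIncl b p.2) :=
      hs.cont.comp (f := fun p : Rn d × Rn d => (coordIncl b p.1, coordIncl b p.2)) (by fun_prop)
    have hsb : ∀ s η : Rn d, ‖symbolAtZero c (coordIncl b s) (coordIncl b η)‖ ≤
        D * (decayWeight (n + 1) s * decayWeight (n + 1) η) := fun s η => by
      refine (hD _ _).trans_eq ?_
      simp [decayWeight, (coordIncl b).norm_map]
    have hsi : Integrable (fun p : Rn d × Rn d =>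
        symbolAtZero c (coordIncl b p.1) (coordIncl b p.2)) (volume.prod volume) :=
      hs.integrable_coordIncl b
    have hsi1 : ∀ s : Rn d, Integrable fun η =>
        symbolAtZero c (coordIncl b s) (coordIncl b η) := fun s =>
      (hwd.const_mul (D * decayWeight (n + 1) s)).mono'
        (hsc.comp (f := fun η : Rn d => (s, η)) (by fun_prop)).aestronglyMeasurable
        (ae_of_all _ fun η => (hsb s η).trans_eq (by ring))
    rw [Measure.volume_eq_prod, integral_prod _ (hJi 0), integral_prod _ (tr.integrable_comp hsi),
      ← integral_smul]
    refine integral_congr_ae (ae_of_all _ fun s => ?_)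
    have hcs : Continuous fun v => c (coordIncl b s) (coordIncl b' v) 0 :=
      hc.cont.comp (f := fun v : Rn r => (coordIncl b s, coordIncl b' v, (0 : ℝ))) (by fun_prop)
    have hci : Integrable fun v => c (coordIncl b s) (coordIncl b' v) 0 := by
      refine (hwr.const_mul (C * decayWeight (n + 1) (coordIncl b s))).mono'
        hcs.aestronglyMeasurable (ae_of_all _ fun v => (hC _ _ _).trans_eq ?_)
      simp [decayWeight, (coordIncl b').norm_map, mul_assoc]
    simp only [J, zero_smul, add_zero]
    rw [integral_comp_normalMap g b' (H := fun v => tr (c (coordIncl b s) (coordIncl b' v) 0))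
      (tr.continuous.comp hcs), ContinuousLinearMap.integral_comp_comm _ hci,
      ContinuousLinearMap.integral_comp_comm _ (hsi1 s),
      ← hc.integral_coordIncl b b' (coordIncl b s) (hsi1 s),
      ContinuousLinearMap.map_smul_of_tower, smul_smul, mul_inv_rev, mul_assoc,
      inv_mul_cancel₀ (by positivity), mul_one]
  rw [← hJ0]
  refine hlim.congr' ?_
  filter_upwards [self_mem_nhdsWithin] with h hh
  exact (hscale h hh).symm

end Limit

section Assembly

variable {n d : ℕ} {F : Type*} [NormedAddCommGroup F] [InnerProductSpace ℂ F]

theorem list_prod_ofFn_smul {A : Type*} [Ring A] [Algebra ℂ A] (m : ℕ) (c : Fin m → ℂ)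
    (a : Fin m → A) :
    (List.ofFn fun i => c i • a i).prod = (∏ i, c i) • (List.ofFn a).prod := by
  induction m with
  | zero => simp
  | succ m ih =>
    simp only [List.ofFn_succ, List.prod_cons, Fin.prod_univ_succ, ih, smul_mul_smul_comm]

theorem prod_parity (c : ℂ) (d : ℕ) :
    ∏ m : Fin (2 * d), (if m.val % 2 = 0 then 1 else c) = c ^ d := by
  rw [Fin.prod_univ_eq_prod_range (fun k => if k % 2 = 0 then 1 else c) (2 * d)]
  induction d with
  | zero => simp
  | succ d ih =>
    rw [show 2 * (d + 1) = 2 * d + 1 + 1 by ring, Finset.prod_range_succ, Finset.prod_range_succ,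
      ih, if_pos (by omega), if_neg (by omega), mul_one, pow_succ]

theorem IsQuantization.list_prod_of_pos [CompleteSpace F] {m : ℕ} (hm : 0 < m)
    {S : Fin m → ℝ → Module.End ℂ 𝓢(Rn n, F)} {Q : Fin m → Rn n → Rn n → F →L[ℂ] F}
    (h : ∀ i, IsQuantization (S i) (Q i)) :
    IsQuantization (fun h => (List.ofFn fun i => S i h).prod)
      (fun x ξ => (List.ofFn fun i => Q i x ξ).prod) := by
  obtain ⟨m, rfl⟩ := Nat.exists_eq_succ_of_ne_zero hm.ne'
  simpa only [List.ofFn_succ, List.prod_cons] using (h 0).list_prod m fun i => h i.succ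

variable {G : Subgroup (Matrix.specialOrthogonalGroup (Fin n) ℝ)}

theorem hatAction_smul (g : G) (γ : F →L[ℂ] F) (s : ℂ) :
    hatAction g (s • γ) = s • hatAction g γ := rfl

/-- Trace class property and localized trace asymptotics for `ĝ A B`. -/
theorem IsQuantization.trace_asymptotics [CompleteSpace F] [FiniteDimensional ℂ F]
    {A B : ℝ → Module.End ℂ 𝓢(Rn n, F)} {P Q : Rn n → Rn n → F →L[ℂ] F}
    (hA : IsQuantization A P) (hB : IsQuantization B Q) (g : G) (γ : F →L[ℂ] F)
    (b : OrthonormalBasis (Fin d) ℝ (fixedSpace g)) :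
    ∃ Z : ℝ → ℂ,
      (∀ h, 0 < h → ∀ s : ℂ, IsTraceClassOnL2 (s • (hatAction g γ * A h * B h)) ∧
        l2Trace (s • (hatAction g γ * A h * B h)) = s * Z h) ∧
      Tendsto (fun h : ℝ => (h ^ d) • Z h) (𝓝[>] 0)
        (𝓝 (((2 * Real.pi) ^ d * detNormal g)⁻¹ • ∫ p : Rn d × Rn d,
          traceCLM F (γ * (P (coordIncl b p.1) (coordIncl b p.2) *
            Q (coordIncl b p.1) (coordIncl b p.2))))) := by
  obtain ⟨hP, k, hk, hAk, rfl⟩ := hA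
  obtain ⟨hQ, k', hk', hBk, rfl⟩ := hB
  have hsym : symbolAtZero (groupoidConv k k') =
      fun x ξ => symbolAtZero k x ξ * symbolAtZero k' x ξ := by
    funext x ξ
    exact hk.symbol_groupoidConv hk' x ξ
  have hc := hk.groupoidConv hk'
  have hs : IsDecayingKernel (symbolAtZero (groupoidConv k k')) := by
    rw [hsym]
    exact hQ.swap.mul_swap hP
  refine ⟨fun h => ∫ y, traceCLM F (γ * scaledKernel (groupoidConv k k') h y (act g y)),
    fun h hh s => ?_, ?_⟩
  · have := l2Trace_hatAction_mul hk hk' hAk hBk g (s • γ) hh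
    rw [hatAction_smul, smul_mul_assoc, smul_mul_assoc] at this
    refine ⟨this.1, this.2.trans ?_⟩
    simp only [smul_mul_assoc, map_smul, smul_eq_mul, integral_const_mul]
  · have := hc.tendsto_trace hs g γ b
    simpa only [hsym] using this

/-- The directions `∂_{x₁}, ∂_{ξ₁}, …` in `T*ℝⁿ × ℝ` attached to a family of vectors. -/
def frameDir (e : Fin d → Rn n) (m : Fin (2 * d)) : Rn n × Rn n × ℝ :=
  if m.val % 2 = 0 then baseDir (e ⟨m.val / 2, by omega⟩) else fibreDir (e ⟨m.val / 2, by omega⟩)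

theorem lie_derivGenerator_rho [CompleteSpace F] (e : Fin d → Rn n) (m : Fin (2 * d))
    (f : 𝓢(Rn n × Rn n × ℝ, F →L[ℂ] F)) {h : ℝ} (hh : 0 < h) :
    ⁅derivGenerator (F := F) e m, rho h f⁆ =
      (if m.val % 2 = 0 then 1 else Complex.I * h) • rho h (∂_{frameDir e m} f) := by
  unfold derivGenerator frameDir
  split_ifs with hm
  · rw [lie_lineDeriv_rho f _ hh, one_smul]
  · rw [lie_coordMul_rho f _ hh]

theorem omegaTerm_rho [CompleteSpace F] (g : G) (γ : F →L[ℂ] F) (e : Fin d → Rn n)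
    (f : Fin (2 * d + 1) → 𝓢(Rn n × Rn n × ℝ, F →L[ℂ] F)) (σ : Equiv.Perm (Fin (2 * d)))
    {h : ℝ} (hh : 0 < h) :
    omegaTerm g γ e (fun i => rho h (f i)) σ = (Complex.I * h) ^ d • (hatAction g γ * rho h (f 0) *
      (List.ofFn fun i => rho h (∂_{frameDir e (σ i)} (f i.succ))).prod) := by
  unfold omegaTerm
  simp_rw [lie_derivGenerator_rho e _ _ hh]
  rw [list_prod_ofFn_smul, mul_smul_comm,
    Equiv.prod_comp σ fun m : Fin (2 * d) => if m.val % 2 = 0 then (1 : ℂ) else Complex.I * h,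
    prod_parity]

theorem fderiv_restrictFixed {g : G} (b : OrthonormalBasis (Fin d) ℝ (fixedSpace g))
    (f : 𝓢(Rn n × Rn n × ℝ, F →L[ℂ] F)) (p : Rn d × Rn d) (m : Fin (2 * d)) :
    fderiv ℝ (restrictFixed b (schwartzSlice 0 f)) p (cotangentFrame d m) =
      (∂_{frameDir (fun j => (b j : Rn n)) m} f) (coordIncl b p.1, coordIncl b p.2, 0) := by
  let L : Rn d × Rn d →L[ℝ] Rn n × Rn n × ℝ :=
    ((coordIncl b).toContinuousLinearMap ∘L ContinuousLinearMap.fst ℝ (Rn d) (Rn d)).prod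
      (((coordIncl b).toContinuousLinearMap ∘L ContinuousLinearMap.snd ℝ (Rn d) (Rn d)).prod 0)
  have hL : HasFDerivAt (restrictFixed b (schwartzSlice 0 f)) (fderiv ℝ f (L p) ∘L L) p :=
    (f.hasFDerivAt (L p)).comp (f := L) p L.hasFDerivAt
  rw [hL.fderiv, SchwartzMap.lineDerivOp_apply_eq_fderiv]
  have hdir : L (cotangentFrame d m) = frameDir (fun j => (b j : Rn n)) m := by
    unfold cotangentFrame frameDir
    split_ifs with hm <;> simp [L, coordIncl_apply, baseDir, fibreDir]
  rw [ContinuousLinearMap.comp_apply, hdir]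
  rfl

/-- The symbol of the `σ`-summand. -/
noncomputable def frameSymbol (e : Fin d → Rn n)
    (f : Fin (2 * d + 1) → 𝓢(Rn n × Rn n × ℝ, F →L[ℂ] F)) (σ : Equiv.Perm (Fin (2 * d)))
    (x ξ : Rn n) : F →L[ℂ] F :=
  f 0 (x, ξ, 0) * (List.ofFn fun i => (∂_{frameDir e (σ i)} (f i.succ)) (x, ξ, 0)).prod

theorem epsilonDensity_eq [FiniteDimensional ℂ F] {g : G} (γ : F →L[ℂ] F)
    (b : OrthonormalBasis (Fin d) ℝ (fixedSpace g))
    (f : Fin (2 * d + 1) → 𝓢(Rn n × Rn n × ℝ, F →L[ℂ] F)) (p : Rn d × Rn d) :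
    epsilonDensity γ b (fun i => schwartzSlice 0 (f i)) p =
      ∑ σ : Equiv.Perm (Fin (2 * d)), ((Equiv.Perm.sign σ : ℤ) : ℂ) * traceCLM F
        (γ * frameSymbol (fun j => (b j : Rn n)) f σ (coordIncl b p.1) (coordIncl b p.2)) := by
  rw [epsilonDensity, ← traceCLM_apply, wedgeEval]
  simp only [fderiv_restrictFixed, Finset.mul_sum, mul_smul_comm, map_sum, map_zsmul]
  refine Finset.sum_congr rfl fun σ _ => ?_
  rw [zsmul_eq_mul]
  rfl

theorem isQuantization_frame_prod [CompleteSpace F] (hd : 0 < d) (e : Fin d → Rn n)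
    (f : Fin (2 * d + 1) → 𝓢(Rn n × Rn n × ℝ, F →L[ℂ] F)) (σ : Equiv.Perm (Fin (2 * d))) :
    IsQuantization (fun h => (List.ofFn fun i => rho h (∂_{frameDir e (σ i)} (f i.succ))).prod)
      (fun x ξ => (List.ofFn fun i => (∂_{frameDir e (σ i)} (f i.succ)) (x, ξ, 0)).prod) :=
  IsQuantization.list_prod_of_pos (by omega) fun i => isQuantization_rho _

theorem integrable_frameSymbol [CompleteSpace F] [FiniteDimensional ℂ F] (hd : 0 < d) {g : G}
    (γ : F →L[ℂ] F) (b : OrthonormalBasis (Fin d) ℝ (fixedSpace g))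
    (f : Fin (2 * d + 1) → 𝓢(Rn n × Rn n × ℝ, F →L[ℂ] F)) (σ : Equiv.Perm (Fin (2 * d))) :
    Integrable fun p : Rn d × Rn d => traceCLM F
      (γ * frameSymbol (fun j => (b j : Rn n)) f σ (coordIncl b p.1) (coordIncl b p.2)) := by
  have h := (isQuantization_rho (f 0)).mul (isQuantization_frame_prod hd (fun j => (b j : Rn n)) f σ)
  exact (traceCLM F).integrable_comp ((h.1.integrable_coordIncl b).const_mul γ)

theorem omega_tendsto_epsilon [CompleteSpace F] [FiniteDimensional ℂ F] (hd : 0 < d) (g : G)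
    (γ : F →L[ℂ] F) (b : OrthonormalBasis (Fin d) ℝ (fixedSpace g))
    (f : Fin (2 * d + 1) → 𝓢(Rn n × Rn n × ℝ, F →L[ℂ] F)) :
    (∀ h : ℝ, 0 < h → ∀ σ : Equiv.Perm (Fin (2 * d)),
      IsTraceClassOnL2 (omegaTerm g γ (fun j => (b j : Rn n)) (fun i => rho h (f i)) σ)) ∧
    Integrable (epsilonDensity γ b (fun i => schwartzSlice 0 (f i))) ∧
    Tendsto (fun h : ℝ => omega g γ (fun j => (b j : Rn n)) (fun i => rho h (f i)))
      (𝓝[>] 0) (𝓝 (epsilon γ b (fun i => schwartzSlice 0 (f i)))) := by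
  have hden : epsilonDensity γ b (fun i => schwartzSlice 0 (f i)) = _ :=
    funext (epsilonDensity_eq γ b f)
  have hint := fun σ => (integrable_frameSymbol hd γ b f σ).const_mul ((Equiv.Perm.sign σ : ℤ) : ℂ)
  choose Z hZ hlim using fun σ : Equiv.Perm (Fin (2 * d)) =>
    (isQuantization_rho (f 0)).trace_asymptotics
      (isQuantization_frame_prod hd (fun j => (b j : Rn n)) f σ) g γ b
  refine ⟨fun h hh σ => ?_, ?_, ?_⟩
  · rw [omegaTerm_rho g γ _ f σ hh]
    exact (hZ σ h hh _).1
  · rw [hden]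
    exact integrable_finsetSum _ fun σ _ => hint σ
  · rw [epsilon, hden, integral_finsetSum _ fun σ _ => hint σ]
    simp_rw [integral_const_mul]
    have hdet : (detNormal g : ℂ) ≠ 0 := by exact_mod_cast (detNormal_pos g).ne'
    have hpi : (Real.pi : ℂ) ≠ 0 := by exact_mod_cast Real.pi_ne_zero
    have hfac : (d.factorial : ℂ) ≠ 0 := by exact_mod_cast d.factorial_ne_zero
    have hconst : 1 / ((2 * Real.pi * Complex.I) ^ d * (d.factorial : ℂ) * (detNormal g : ℂ)) =
        (-1) ^ d / (d.factorial : ℂ) * (Complex.I ^ d *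
          ((((2 * Real.pi) ^ d * detNormal g)⁻¹ : ℝ) : ℂ)) := by
      have hI : (-1 : ℂ) ^ d * Complex.I ^ d * Complex.I ^ d = 1 := by
        rw [← mul_pow, ← mul_pow, neg_one_mul, neg_mul, Complex.I_mul_I, neg_neg, one_pow]
      push_cast
      rw [mul_pow, mul_pow]
      field_simp
      linear_combination -hI
    rw [hconst, mul_assoc, Finset.mul_sum]
    have hterm : Tendsto (fun h : ℝ => (-1) ^ d / (d.factorial : ℂ) *
        ∑ σ : Equiv.Perm (Fin (2 * d)), ((Equiv.Perm.sign σ : ℤ) : ℂ) *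
          (Complex.I ^ d * ((h ^ d) • Z σ h))) (𝓝[>] 0) _ :=
      (tendsto_finsetSum _ fun σ _ => ((hlim σ).const_mul _).const_mul _).const_mul _
    refine (hterm.congr' ?_).trans (le_of_eq ?_)
    · filter_upwards [self_mem_nhdsWithin] with h hh
      rw [omega]
      congr 1
      refine Finset.sum_congr rfl fun σ _ => ?_
      rw [omegaTerm_rho g γ _ f σ hh, (hZ σ h hh _).2, mul_pow, Complex.real_smul]
      push_cast
      ring
    · congr 2
      refine Finset.sum_congr rfl fun σ _ => ?_
      rw [Complex.real_smul]
      simp only [frameSymbol]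
      ring

end Assembly

end EquivariantIndex

theorem lemma3p9 {n k l d : ℕ} (G : Subgroup (Matrix.specialOrthogonalGroup (Fin n) ℝ))
    (hG : IsCompact (G : Set (Matrix.specialOrthogonalGroup (Fin n) ℝ)))
    (ρV : Representation ℂ G (EuclideanSpace ℂ (Fin k)))
    (ρW : Representation ℂ G (EuclideanSpace ℂ (Fin l)))
    (g : G) (hdim : Module.finrank ℝ (fixedSpace g) = d) (hd : 0 < d)
    (b : OrthonormalBasis (Fin d) ℝ (fixedSpace g))
    (f : Fin (2 * d + 1) → 𝓢(Rn n × Rn n × ℝ, Fibre k l →L[ℂ] Fibre k l)) :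
    (∀ ħ : ℝ, 0 < ħ → ∀ σ : Equiv.Perm (Fin (2 * d)),
      IsTraceClassOnL2 (omegaTerm g (blockDiag (ρV g) (ρW g)) (fun j => (b j : Rn n))
        (fun i => rho ħ (f i)) σ)) ∧
    Integrable (epsilonDensity (blockDiag (ρV g) (ρW g)) b (fun i => schwartzSlice 0 (f i))) ∧
    Tendsto (fun ħ : ℝ => omega g (blockDiag (ρV g) (ρW g)) (fun j => (b j : Rn n))
        (fun i => rho ħ (f i)))
      (𝓝[>] 0) (𝓝 (epsilon (blockDiag (ρV g) (ρW g)) b (fun i => schwartzSlice 0 (f i)))) := by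
  have : FiniteDimensional ℂ (Fibre k l) :=
    Module.Finite.equiv (WithLp.linearEquiv 2 ℂ
      (EuclideanSpace ℂ (Fin k) × EuclideanSpace ℂ (Fin l))).symm
  exact omega_tendsto_epsilon hd g _ b f
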